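/- For $n\ge 1$ let $\varphi^{\mathrm{Wall}}_{\mathrm{Comm}}(n)$ be the following CNF formula on the input bits $x_0,\dots,x_{n-1},y_0,\dots,y_{n-1}$. It consists of two Wallace tree multipliers, $L$ with inputs $(u,v)=(x,y)$ and $R$ with inputs $(u,v)=(y,x)$, and of inequality constraints. Every constraint "$z=f(a_1,\dots,a_k)$" below is encoded by its $2^k$ clauses $(a=\alpha)\rightarrow z=f(\alpha)$, $\alpha\in\{0,1\}^k$; constant inputs $0$ are substituted. *Multiplier* $C\in\{L,R\}$. The tableau has layers $0,1,\dots,h$ and columns $0,\dots,2n-1$; a variable in column $i$ has weight $2^i$. Column $i$ of layer $0$ consists of the partial products $u_{i-j}\wedge v_j$ ($0\le j<n$, $0\le i-j<n$) in order of increasing $j$. To obtain layer $l+1$ from layer $l$, each column is cut in order into groups of three variables, the last group possibly having only one or two. A group of three (two, one) is fed into a full adder (half adder, wire); each of these has as output a new variable, its sum-bit, equal to the XOR of its inputs, and full and half adders also have a new variable, their carry-bit, equal to the majority of their inputs (missing inputs being $0$). For $j=0,1,2,\dots$ in turn, first the sum-bit of the $j$-th group of every column $i$ is appended to column $i$ of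 layer $l+1$, and then the carry-bit of the $j$-th group of every column $i$ is appended to column $i+1$ of layer $l+1$ (carries out of column $2n-1$, which would always be $0$, are omitted). The last layer $h$ is the first one in which every column has at most two variables. Its two rows $a,b$, padded with zeros to $4^m\ge 2n$ bits with $m$ least possible, are added by a $4$-ary carry-lookahead adder with carry-in $c_0=0$: it has variables $g^0_i=a_i\wedge b_i$, $p^0_i=a_i\oplus b_i$; for each level $l<m$ and each aligned group of four blocks of that level, with generate bits $g_0,\dots,g_3$, propagate bits $p_0,\dots,p_3$ and incoming carry $c$, it has variables for the carries into blocks $1,2,3$, given by $g_0\oplus cp_0$, $\;g_1\oplus g_0p_1\oplus cp_0p_1$, $\;g_2\oplus g_1p_2\oplus g_0p_1p_2\oplus cp_0p_1p_2$, and for the group generate $g_3\oplus g_2p_3\oplus g_1p_2p_3\oplus g_0p_1p_2p_3$ and the group propagate $p_0p_1p_2p_3$, which are the generate and propagate bits of the merged block in level $l+1$. The outputs are $o^C_i=c_i\oplus a_i\oplus b_i$, $0\le i<2n$. *Inequality constraints.* $e_i=(\neg o^L_i\wedge o^R_i)\vee(o^L_i\wedge\neg o^R_i)$ for $0\le i<2n$,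 and the clause $e_0\vee e_1\vee\dots\vee e_{2n-1}$. A resolution refutation of a CNF formula is a sequence of clauses ending in the empty clause, each of which is a clause of the formula or the resolvent $C\vee D$ of two earlier clauses $C\vee x$ and $D\vee\bar x$; its size is the number of its clauses. It is regular if on every path of the associated directed acyclic graph each variable is resolved on at most once. **Theorem.** There is a constant $K>0$ such that for every $n\ge 2$ the formula $\varphi^{\mathrm{Wall}}_{\mathrm{Comm}}(n)$ has a regular resolution refutation of size at most $2^{K(\log_2 n)^2}$; that is, of size $2^{O(\log^2 n)}$. -/

import Mathlib

/-! ## Clauses and regular resolution -/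

/-- A literal: the variable `v` is written `(v, true)`, its negation `(v, false)`. -/
abbrev Literal (V : Type) := V × Bool

/-- A clause is a finite set of literals. -/
abbrev Clause (V : Type) := Finset (Literal V)

/-- A resolution refutation of the CNF formula `φ`, as a sequence of `size` clauses together with
the edges of its directed acyclic graph.  If `rule i = none`, line `i` is a clause of `φ`; if
`rule i = some (x, a, b)`, line `i` is the resolvent on `x` of the earlier lines `a` (of the form
`C ∨ x`) and `b` (of the form `D ∨ ¬x`).  The last line is the empty clause. -/
structure ResolutionRefutation {V : Type} [DecidableEq V] (φ : Finset (Clause V)) where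
  size : ℕ
  clause : Fin size → Clause V
  rule : Fin size → Option (V × Fin size × Fin size)
  input_mem : ∀ i, rule i = none → clause i ∈ φ
  resolvent : ∀ i x a b, rule i = some (x, a, b) →
    a < i ∧ b < i ∧ (x, true) ∈ clause a ∧ (x, false) ∈ clause b ∧
      clause i = (clause a).erase (x, true) ∪ (clause b).erase (x, false)
  ends_empty : ∃ i : Fin size, i.val + 1 = size ∧ clause i = ∅

namespace ResolutionRefutation

variable {V : Type} [DecidableEq V] {φ : Finset (Clause V)}

/-- Line `a` is one of the two premises of line `i`: an edge of the DAG. -/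
def IsPremise (π : ResolutionRefutation φ) (a i : Fin π.size) : Prop :=
  ∃ x b, π.rule i = some (x, a, b) ∨ π.rule i = some (x, b, a)

/-- Line `i` is obtained by resolving on the variable `x`. -/
def ResolvesOn (π : ResolutionRefutation φ) (i : Fin π.size) (x : V) : Prop :=
  ∃ a b, π.rule i = some (x, a, b)

/-- Regularity: no two different lines on a common path of the DAG resolve on the same variable. -/
def IsRegular (π : ResolutionRefutation φ) : Prop :=
  ∀ (i j : Fin π.size) (x : V), Relation.TransGen π.IsPremise j i →
    π.ResolvesOn i x → ¬ π.ResolvesOn j x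

end ResolutionRefutation

/-! ## Encoding of gates -/

/-- The clauses of the constraint `z = f (ins 0, …, ins (k-1))`: for each assignment `α` of the
inputs, the clause `(inputs = α) → z = f α`.  An input `none` is the constant `0`. -/
def gate {V : Type} [DecidableEq V] (z : V) {k : ℕ} (ins : Fin k → Option V)
    (f : (Fin k → Bool) → Bool) : Finset (Clause V) :=
  (Finset.univ.filter fun α : Fin k → Bool => ∀ s, ins s = none → α s = false).image fun α =>
    insert (z, f α) (Finset.univ.biUnion fun s : Fin k =>
      match ins s with
      | none => ∅
      | some v => {(v, !α s)})

/-- Conjunction of two bits. -/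
def and2 (a : Fin 2 → Bool) : Bool := a 0 && a 1

/-- Exclusive or of two bits. -/
def xor2 (a : Fin 2 → Bool) : Bool := a 0 ^^ a 1

/-- Sum-bit of an adder. -/
def xor3 (a : Fin 3 → Bool) : Bool := a 0 ^^ a 1 ^^ a 2

/-- Carry-bit of an adder. -/
def maj3 (a : Fin 3 → Bool) : Bool := (a 0 && a 1) || (a 0 && a 2) || (a 1 && a 2)

/-! ## Variables -/

/-- The two multiplier circuits: `L` computes `xy`, `R` computes `yx`. -/
inductive Side where
  | L
  | R
deriving DecidableEq

/-- The variables of the commutativity instance. -/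
inductive WVar where
  /-- input bits `x_i` -/
  | x (i : ℕ)
  /-- input bits `y_i` -/
  | y (i : ℕ)
  /-- tableau variable of circuit `C` in layer `l`, column `i` (weight `2^i`), at position `r` of
  that subcolumn (positions are counted from `0`) -/
  | t (C : Side) (l i r : ℕ)
  /-- generate bit of block `k` of level `l` of the carry-lookahead adder, that is of the bit
  positions `4^l * k, …, 4^l * (k+1) - 1` -/
  | g (C : Side) (l k : ℕ)
  /-- propagate bit of that block -/
  | p (C : Side) (l k : ℕ)
  /-- carry into bit position `i` of the carry-lookahead adder, `i > 0` -/
  | c (C : Side) (i : ℕ)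
  /-- output bits -/
  | o (C : Side) (i : ℕ)
  /-- comparison bits -/
  | e (i : ℕ)
deriving DecidableEq

namespace Wallace

/-! ## Shape of the Wallace tree

The tableau has the columns `0, …, 2n-1`.  (The product has `2n` bits; a carry out of column
`2n-1` would always be `0` and is omitted.)  In every layer each column is cut, from the top, into
groups of three variables, the last group having possibly one or two.  A group of three is the
input of a full adder, a group of two of a half adder, each of which has a sum-bit and a carry-bit;
a group of one is the input of a wire, whose only output is its sum-bit, the carry being the
constant `0`. -/

/-- Number of sum-bits (adders, half adders and wires) for a column of `N` variables. -/
def numSums (N : ℕ) : ℕ := (N + 2) / 3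

/-- Number of carry-bits (adders and half adders) for a column of `N` variables. -/
def numCarries (N : ℕ) : ℕ := (N + 1) / 3

/-- Number of variables in column `i` of the tableau in layer `l` of the `n`-bit multiplier. -/
def height (n : ℕ) : ℕ → ℕ → ℕ
  | 0, i => if i < n then i + 1 else 2 * n - 1 - i
  | l + 1, 0 => if 0 < n then numSums (height n l 0) else 0
  | l + 1, i + 1 =>
      if i + 1 < 2 * n then numSums (height n l (i + 1)) + numCarries (height n l i) else 0

/-- Number of carry-bits that column `i` receives from column `i - 1`, in passing from layer `l` to
layer `l + 1`. -/
def carriesInto (n l : ℕ) : ℕ → ℕ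
  | 0 => 0
  | i + 1 => numCarries (height n l i)

/-- The outputs of the adders of layer `l` are appended to the columns of layer `l + 1` in the order
of the row `j` of the adder, and for each `j` first the sum-bits, then the carry-bits.  The sum-bit
of the `j`-th adder of column `i` therefore comes in column `i` after `j` sum-bits and at most `j`
carry-bits. -/
def sumPos (n l i j : ℕ) : ℕ := j + min j (carriesInto n l i)

/-- The carry-bit of the `j`-th adder of column `i` comes in column `i + 1` after `j` carry-bits and
at most `j + 1` sum-bits. -/
def carryPos (n l i j : ℕ) : ℕ := min (j + 1) (numSums (height n l (i + 1))) + j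

theorem height_le_sub (n : ℕ) : ∀ l i, height n l i ≤ max 2 (n - l)
  | 0, i => by
      simp only [height]
      split <;> omega
  | l + 1, 0 => by
      have h := height_le_sub n l 0
      simp only [height, numSums]
      split <;> omega
  | l + 1, i + 1 => by
      have h := height_le_sub n l (i + 1)
      have h' := height_le_sub n l i
      simp only [height, numSums, numCarries]
      split <;> omega

theorem exists_two_rows (n : ℕ) : ∃ l, ∀ i < 2 * n, height n l i ≤ 2 :=
  ⟨n, fun i _ => by have := height_le_sub n n i; omega⟩

/-- The index of the last layer: the first one whose tableau has at most two rows. -/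
def lastLayer (n : ℕ) : ℕ := Nat.find (exists_two_rows n)

/-! ## The circuit -/

/-- The bit at position `r` of column `i` in layer `l`; the constant `0` if there is none. -/
def cell (n : ℕ) (C : Side) (l i r : ℕ) : Option WVar :=
  if r < height n l i then some (.t C l i r) else none

/-- The three inputs of the `j`-th adder of column `i` in layer `l`. -/
def adderInputs (n : ℕ) (C : Side) (l i j : ℕ) : Fin 3 → Option WVar :=
  ![cell n C l i (3 * j), cell n C l i (3 * j + 1), cell n C l i (3 * j + 2)]

/-- The partial products: the variables of column `i` of layer `0` are the `u_{i-j} ∧ v_j` with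
`j < n` and `0 ≤ i - j < n`, in the order of increasing `j`; the least such `j` is
`max (0, i - (n-1))`. -/
def partialProducts (n : ℕ) (C : Side) (u v : ℕ → WVar) : Finset (Clause WVar) :=
  (Finset.range (2 * n)).biUnion fun i =>
    (Finset.range (height n 0 i)).biUnion fun r =>
      gate (.t C 0 i r) ![some (u (i - (i - (n - 1) + r))), some (v (i - (n - 1) + r))] and2

/-- The layers of adders. -/
def adders (n : ℕ) (C : Side) : Finset (Clause WVar) :=
  (Finset.range (lastLayer n)).biUnion fun l =>
    (Finset.range (2 * n)).biUnion fun i =>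
      ((Finset.range (numSums (height n l i))).biUnion fun j =>
        gate (.t C (l + 1) i (sumPos n l i j)) (adderInputs n C l i j) xor3) ∪
      if i + 1 < 2 * n then
        (Finset.range (numCarries (height n l i))).biUnion fun j =>
          gate (.t C (l + 1) (i + 1) (carryPos n l i j)) (adderInputs n C l i j) maj3
      else ∅

/-- Number of levels of the carry-lookahead adder: it adds two numbers of `4 ^ claLevels n ≥ 2n`
bits, the two rows of the last layer padded with the constant `0`. -/
def claLevels (n : ℕ) : ℕ := Nat.clog 4 (2 * n)

/-- The carry into bit position `i`; there is no carry into position `0`. -/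
def carry (C : Side) (i : ℕ) : Option WVar := if i = 0 then none else some (.c C i)

/-- The `4`-bit carry-lookahead unit number `k` of level `l`.  From the generate and propagate bits
of its four subblocks `4k, …, 4k+3` and the carry into the first of them it computes the carries
into the other three, and the group generate and group propagate bits.  The carry out of the unit
is computed by a unit of a higher level. -/
def claUnit (C : Side) (l k : ℕ) : Finset (Clause WVar) :=
  let cin := carry C (4 ^ l * (4 * k))
  let g (s : ℕ) : Option WVar := some (.g C l (4 * k + s))
  let p (s : ℕ) : Option WVar := some (.p C l (4 * k + s))
  gate (.c C (4 ^ l * (4 * k + 1))) ![cin, g 0, p 0]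
    (fun a => a 1 ^^ (a 0 && a 2)) ∪
  gate (.c C (4 ^ l * (4 * k + 2))) ![cin, g 0, p 0, g 1, p 1]
    (fun a => a 3 ^^ (a 1 && a 4) ^^ (a 0 && a 2 && a 4)) ∪
  gate (.c C (4 ^ l * (4 * k + 3))) ![cin, g 0, p 0, g 1, p 1, g 2, p 2]
    (fun a => a 5 ^^ (a 3 && a 6) ^^ (a 1 && a 4 && a 6) ^^ (a 0 && a 2 && a 4 && a 6)) ∪
  gate (.g C (l + 1) k) ![g 0, g 1, p 1, g 2, p 2, g 3, p 3]
    (fun a => a 5 ^^ (a 3 && a 6) ^^ (a 1 && a 4 && a 6) ^^ (a 0 && a 2 && a 4 && a 6)) ∪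
  gate (.p C (l + 1) k) ![p 0, p 1, p 2, p 3]
    (fun a => a 0 && a 1 && a 2 && a 3)

/-- The carry-lookahead adder that adds the two rows of the last layer. -/
def carryLookahead (n : ℕ) (C : Side) : Finset (Clause WVar) :=
  let a (i : ℕ) := cell n C (lastLayer n) i 0
  let b (i : ℕ) := cell n C (lastLayer n) i 1
  ((Finset.range (4 ^ claLevels n)).biUnion fun i =>
    gate (.g C 0 i) ![a i, b i] and2 ∪ gate (.p C 0 i) ![a i, b i] xor2) ∪
  ((Finset.range (claLevels n)).biUnion fun l =>
    (Finset.range (4 ^ (claLevels n - (l + 1)))).biUnion fun k => claUnit C l k) ∪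
  ((Finset.range (2 * n)).biUnion fun i =>
    gate (.o C i) ![carry C i, a i, b i] xor3)

/-- The Wallace tree multiplier with inputs `u`, `v` and outputs `o_0, …, o_{2n-1}`. -/
def multiplier (n : ℕ) (C : Side) (u v : ℕ → WVar) : Finset (Clause WVar) :=
  partialProducts n C u v ∪ adders n C ∪ carryLookahead n C

/-- The inequality constraints: `e_i = (¬ o^L_i ∧ o^R_i) ∨ (o^L_i ∧ ¬ o^R_i)` for all `i < 2n`, and
`e_0 ∨ … ∨ e_{2n-1}`. -/
def inequality (n : ℕ) : Finset (Clause WVar) :=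
  ((Finset.range (2 * n)).biUnion fun i =>
    gate (.e i) ![some (.o .L i), some (.o .R i)] (fun a => (!a 0 && a 1) || (a 0 && !a 1))) ∪
  {(Finset.range (2 * n)).image fun i => (WVar.e i, true)}

/-- The commutativity instance for `n`-bit Wallace tree multipliers. -/
def commInstance (n : ℕ) : Finset (Clause WVar) :=
  multiplier n .L .x .y ∪ multiplier n .R .y .x ∪ inequality n

end Wallace

/-! The two multipliers have the same partial products in every column, and comparing their outputs
at one position needs only logarithmically many columns. Fix a position k and the strip of columns
lo, ..., k, with w = k - lo of order log n. Modulo 2^(w+1), the outputs of the strip in either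
multiplier spell the weighted sum of its partial products plus the carries entering at column lo.
There are at most n such carries per layer and one in the final adder, in total fewer than 2^w (none
if lo = 0). If the outputs agree at lo, ..., k-1 and differ at k, the two sums differ by an odd
multiple of 2^w modulo 2^(w+1), yet by less than 2^w, which is absurd (`not_models_stripClauses`).
So the strip implies the clause ¬e_k ∨ e_lo ∨ ... ∨ e_(k-1).

This clause, or a subclause, is derived by Davis–Putnam elimination of all other variables of the
strip. If variables carry time intervals such that the variables of a common clause meet pairwise,
then eliminating in the order of right end points produces only clauses over variables live at one
time (`exists_eliminates`); B live variables cost 4^O(B) clauses per elimination. Here B is of order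
log² n. The last layer and the adder are kept live throughout, with O(log n) variables per position,
since only the lookahead units above that position matter. The tableau is read row by row, an adder
acting when its last input is known; then four cells per column and layer are live at a time
(`card_alive_le`), and the input bits pass through windows of width k - lo + 1. The columns of R
list the partial products in reverse order, so R is read backwards and both circuits meet the same
input bits at the same time.

Finally e_0 ∨ ... ∨ e_(2n-1) is resolved with the strip clauses for k = 2n-1, ..., 0
(`exists_chain`). Regularity is tracked by annotating each clause with a set containing the
variables resolved above it: a pivot must be new to both premises
(`IsDerivation.exists_refutation`), and strip derivations never resolve on a comparison bit. -/

/-! ## Derivations as sets of annotated clauses -/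

section Derivation

variable {V : Type} [DecidableEq V]

/-- `(C, M)` stands for a derivation of the clause `C` in which only variables of `M` are resolved.
It is justified by `S` if `C` is a clause of `φ`, or the resolvent of two clauses of `S` on a
variable of `M` that has not been resolved in their derivations. -/
def Justified (φ : Finset (Clause V)) (S : Finset (Clause V × Finset V))
    (q : Clause V × Finset V) : Prop :=
  q.1 ∈ φ ∨ ∃ x, ∃ a ∈ S, ∃ b ∈ S, x ∉ a.2 ∧ x ∉ b.2 ∧ a.2 ⊆ q.2 ∧ b.2 ⊆ q.2 ∧ x ∈ q.2 ∧
    (x, true) ∈ a.1 ∧ (x, false) ∈ b.1 ∧ q.1 = a.1.erase (x, true) ∪ b.1.erase (x, false)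

theorem Justified.mono {φ : Finset (Clause V)} {S S' : Finset (Clause V × Finset V)}
    {q : Clause V × Finset V} (h : Justified φ S q) (hS : S ⊆ S') : Justified φ S' q := by
  rcases h with h | ⟨x, a, ha, b, hb, h⟩
  · exact Or.inl h
  · exact Or.inr ⟨x, a, hS ha, b, hS hb, h⟩

/-- Every annotated clause of `S` is justified by `S`. -/
def IsDerivation (φ : Finset (Clause V)) (S : Finset (Clause V × Finset V)) : Prop :=
  ∀ q ∈ S, Justified φ S q

/-- A resolution step strictly enlarges the annotation, so sorting by its size turns a set of
annotated clauses into a sequence with premises first. -/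
theorem exists_sorted_enumeration {α : Type} (S : Finset α) (rank : α → ℕ) :
    ∃ nd : Fin S.card → α, (∀ i, nd i ∈ S) ∧ (∀ q ∈ S, ∃ i, nd i = q) ∧
      ∀ i j, rank (nd i) < rank (nd j) → i < j := by
  let f : Fin S.card → ℕ := fun i => rank (S.equivFin.symm i)
  refine ⟨fun i => S.equivFin.symm (Tuple.sort f i), fun i => Subtype.coe_prop _, ?_, ?_⟩
  · intro q hq
    refine ⟨(Tuple.sort f).symm (S.equivFin ⟨q, hq⟩), ?_⟩
    simp
  · intro i j hij
    by_contra hji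
    exact absurd (Tuple.monotone_sort f (not_lt.mp hji)) (not_le.mpr hij)

/-- A derivation of the empty clause yields a regular refutation. -/
theorem IsDerivation.exists_refutation {φ : Finset (Clause V)}
    {S : Finset (Clause V × Finset V)} (hS : IsDerivation φ S) {M : Finset V}
    (hM : ((∅ : Clause V), M) ∈ S) :
    ∃ π : ResolutionRefutation φ, π.IsRegular ∧ π.size ≤ S.card := by
  obtain ⟨nd, hmem, hsurj, hlt⟩ := exists_sorted_enumeration S fun q => q.2.card
  obtain ⟨r, hr⟩ := hsurj _ hM
  -- The sequence is cut off at the empty clause, which thereby becomes the last line.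
  let nd' : Fin (r.val + 1) → Clause V × Finset V := fun i => nd (i.castLE r.isLt)
  have key : ∀ i : Fin (r.val + 1), ∃ o : Option (V × Fin (r.val + 1) × Fin (r.val + 1)),
      (o = none → (nd' i).1 ∈ φ) ∧ ∀ x a b, o = some (x, a, b) →
        (a < i ∧ b < i ∧ (x, true) ∈ (nd' a).1 ∧ (x, false) ∈ (nd' b).1 ∧
          (nd' i).1 = (nd' a).1.erase (x, true) ∪ (nd' b).1.erase (x, false)) ∧
        x ∉ (nd' a).2 ∧ x ∉ (nd' b).2 ∧ (nd' a).2 ⊆ (nd' i).2 ∧ (nd' b).2 ⊆ (nd' i).2 ∧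
          x ∈ (nd' i).2 := by
    intro i
    rcases hS (nd' i) (hmem _) with h | ⟨x, a, ha, b, hb, hxa, hxb, ha', hb', hx, hxa', hxb', h⟩
    · exact ⟨none, fun _ => h, by simp⟩
    · have aux : ∀ a ∈ S, x ∉ a.2 → a.2 ⊆ (nd' i).2 → ∃ j : Fin (r.val + 1), j < i ∧ nd' j = a := by
        intro a ha hxa ha'
        obtain ⟨j, rfl⟩ := hsurj a ha
        -- The pivot lies in the annotation of the conclusion but not of the premise, so the
        -- inclusion is proper.
        have hji : j < i.castLE r.isLt := hlt _ _ (Finset.card_lt_card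
          ⟨ha', fun hsub => hxa (hsub hx)⟩)
        have hji' : j.val < i.val := hji
        exact ⟨⟨j.val, by omega⟩, hji', rfl⟩
      obtain ⟨ja, hja, rfl⟩ := aux a ha hxa ha'
      obtain ⟨jb, hjb, rfl⟩ := aux b hb hxb hb'
      refine ⟨some (x, ja, jb), by simp, ?_⟩
      rintro x' a' b' heq
      simp only [Option.some.injEq, Prod.mk.injEq] at heq
      obtain ⟨rfl, rfl, rfl⟩ := heq
      exact ⟨⟨hja, hjb, hxa', hxb', h⟩, hxa, hxb, ha', hb', hx⟩
  choose rule hnone hsome using key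
  let π : ResolutionRefutation φ :=
    { size := r.val + 1
      clause := fun i => (nd' i).1
      rule := rule
      input_mem := hnone
      resolvent := fun i x a b h => (hsome i x a b h).1
      ends_empty := ⟨Fin.last _, rfl, congrArg Prod.fst hr⟩ }
  have hsub : ∀ j i, π.IsPremise j i → (nd' j).2 ⊆ (nd' i).2 := by
    rintro j i ⟨x, b, h | h⟩
    · exact (hsome _ _ _ _ h).2.2.2.1
    · exact (hsome _ _ _ _ h).2.2.2.2.1
  have hsub' : ∀ j i, Relation.ReflTransGen π.IsPremise j i → (nd' j).2 ⊆ (nd' i).2 := by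
    intro j i h
    induction h with
    | refl => exact subset_rfl
    | tail _ h ih => exact ih.trans (hsub _ _ h)
  refine ⟨π, ?_, r.isLt⟩
  rintro i j x hji ⟨a, b, hi⟩ ⟨a', b', hj⟩
  obtain ⟨c, hjc, hci⟩ := Relation.TransGen.tail'_iff.mp hji
  -- Annotations grow along paths, so the earlier pivot belongs to the annotation of the premise `c`
  -- of `i`; the pivot of `i` does not.
  have hx : x ∈ (nd' c).2 := hsub' _ _ hjc (hsome _ _ _ _ hj).2.2.2.2.2
  obtain ⟨x', b'', h | h⟩ := hci
  · obtain ⟨rfl, rfl, -⟩ : x' = x ∧ c = a ∧ b'' = b := by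
      have := h.symm.trans hi
      simpa using this
    exact (hsome _ _ _ _ hi).2.1 hx
  · obtain ⟨rfl, -, rfl⟩ : x' = x ∧ b'' = a ∧ c = b := by
      have := h.symm.trans hi
      simpa using this
    exact (hsome _ _ _ _ hi).2.2.1 hx

end Derivation

/-! ## Variable elimination -/

section Elimination

variable {V : Type} [DecidableEq V]

/-- The variables of a clause. -/
def Clause.vars (C : Clause V) : Finset V := C.image Prod.fst

theorem Clause.mem_vars {C : Clause V} {p : Literal V} (h : p ∈ C) : p.1 ∈ Clause.vars C :=
  Finset.mem_image_of_mem _ h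

/-- The assignment `α` falsifies the clause `C`. -/
def Falsifies (α : V → Bool) (C : Clause V) : Prop := ∀ q ∈ C, α q.1 ≠ q.2

theorem Falsifies.congr {α β : V → Bool} {C : Clause V} (h : Falsifies α C)
    (hαβ : ∀ v ∈ Clause.vars C, β v = α v) : Falsifies β C := fun q hq => by
  rw [hαβ _ (Clause.mem_vars hq)]; exact h q hq

/-- The clauses that contain a variable of `M`. -/
def touching (ψ : Finset (Clause V)) (M : Finset V) : Finset (Clause V) :=
  ψ.filter fun D => ∃ v ∈ Clause.vars D, v ∈ M

/-- The variables outside of `M` that share a clause with a variable of `M`. -/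
def clauseFrontier (ψ : Finset (Clause V)) (M : Finset V) : Finset V :=
  (touching ψ M).biUnion Clause.vars \ M

theorem mem_clauseFrontier {ψ : Finset (Clause V)} {M : Finset V} {u : V} :
    u ∈ clauseFrontier ψ M ↔ (∃ D ∈ ψ, (∃ v ∈ Clause.vars D, v ∈ M) ∧ u ∈ Clause.vars D) ∧ u ∉ M := by
  simp only [clauseFrontier, touching, Finset.mem_sdiff, Finset.mem_biUnion, Finset.mem_filter, and_assoc]

theorem clauseFrontier_subset_insert (ψ : Finset (Clause V)) (M : Finset V) (a : V) :
    clauseFrontier ψ M ⊆ insert a (clauseFrontier ψ (insert a M)) := by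
  intro u hu
  obtain ⟨⟨D, hD, ⟨v, hv, hvM⟩, huD⟩, huM⟩ := mem_clauseFrontier.mp hu
  by_cases hua : u = a
  · exact hua ▸ Finset.mem_insert_self _ _
  · exact Finset.mem_insert_of_mem <| mem_clauseFrontier.mpr
      ⟨⟨D, hD, ⟨v, hv, Finset.mem_insert_of_mem hvM⟩, huD⟩, by simp [hua, huM]⟩

/-- Every assignment that cannot be changed on `M` so as to satisfy the clauses touching `M`
falsifies a clause of `S` over the frontier of `M`. -/
def Eliminates (ψ : Finset (Clause V)) (S : Finset (Clause V × Finset V)) (M : Finset V) : Prop :=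
  ∀ α : V → Bool, (∀ β : V → Bool, (∀ v ∉ M, β v = α v) → ∃ D ∈ touching ψ M, Falsifies β D) →
    ∃ q ∈ S, q.2 ⊆ M ∧ Falsifies α q.1 ∧ Clause.vars q.1 ⊆ clauseFrontier ψ M

/-- The clauses with variables in `B`. -/
def clausesOver (B : Finset V) : Finset (Clause V) := (B ×ˢ Finset.univ).powerset

theorem mem_clausesOver {B : Finset V} {C : Clause V} :
    C ∈ clausesOver B ↔ Clause.vars C ⊆ B := by
  simp only [clausesOver, Finset.mem_powerset, Clause.vars]
  constructor
  · intro h v hv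
    obtain ⟨q, hq, rfl⟩ := Finset.mem_image.mp hv
    exact (Finset.mem_product.mp (h hq)).1
  · intro h q hq
    exact Finset.mem_product.mpr ⟨h (Finset.mem_image_of_mem _ hq), Finset.mem_univ _⟩

theorem card_clausesOver {X : Type} (B : Finset X) : (clausesOver B).card = 4 ^ B.card := by
  rw [clausesOver, Finset.card_powerset, Finset.card_product, Finset.card_univ, Fintype.card_bool,
    mul_comm, pow_mul]
  norm_num

/-- One Davis–Putnam step. For an assignment α that cannot be repaired on `insert a M`, each value
of `a` yields a falsified clause over `B` and `a`; resolving the two on `a` gives the required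
clause. Only clauses over the frontier are added, whence the bound. -/
theorem Eliminates.exists_insert {φ ψ : Finset (Clause V)} (hψ : ψ ⊆ φ)
    {S : Finset (Clause V × Finset V)} {M : Finset V} (hS : IsDerivation φ S)
    (hE : Eliminates ψ S M) (hSM : ∀ q ∈ S, q.2 ⊆ M) {a : V} (ha : a ∉ M) {w : ℕ}
    (hw : (clauseFrontier ψ (insert a M)).card ≤ w) :
    ∃ S' : Finset (Clause V × Finset V), IsDerivation φ S' ∧ Eliminates ψ S' (insert a M) ∧
      (∀ q ∈ S', q.2 ⊆ insert a M) ∧ S'.card ≤ S.card + 2 * 4 ^ (w + 1) := by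
  classical
  set B := clauseFrontier ψ (insert a M) with hB
  -- `S₁` adds the needed input clauses with empty annotation, and `S₂` all resolvents over `B`;
  -- each family has at most 4^(w+1) members.
  let S₁ := S ∪ ((clausesOver (insert a B)).filter (· ∈ ψ)).image fun C => (C, (∅ : Finset V))
  let S₂ := ((clausesOver B).image fun C => (C, insert a M)).filter (Justified φ S₁)
  have hcB : (insert a B).card ≤ w + 1 := (Finset.card_insert_le _ _).trans (by omega)
  refine ⟨S₁ ∪ S₂, ?_, ?_, ?_, ?_⟩
  · intro q hq
    rcases Finset.mem_union.mp hq with hq | hq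
    · rcases Finset.mem_union.mp hq with hq | hq
      · exact (hS q hq).mono (Finset.subset_union_left.trans Finset.subset_union_left)
      · obtain ⟨C, hC, rfl⟩ := Finset.mem_image.mp hq
        exact Or.inl (hψ (Finset.mem_filter.mp hC).2)
    · exact (Finset.mem_filter.mp hq).2.mono Finset.subset_union_left
  · intro α hα
    have half : ∀ b : Bool, ∃ q ∈ S₁, q.2 ⊆ M ∧ Falsifies (Function.update α a b) q.1 ∧
        Clause.vars q.1 ⊆ insert a B := by
      intro b
      by_cases hbad : ∀ β : V → Bool, (∀ v ∉ M, β v = Function.update α a b v) →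
          ∃ D ∈ touching ψ M, Falsifies β D
      · obtain ⟨q, hq, hqM, hqα, hqB⟩ := hE _ hbad
        exact ⟨q, Finset.mem_union_left _ hq, hqM, hqα,
          hqB.trans (clauseFrontier_subset_insert ψ M a)⟩
      -- Here β repairs all clauses touching `M`. The clause `D` it still falsifies therefore
      -- contains `a` and avoids `M`, so the unrepaired assignment falsifies `D` too, and `D` serves
      -- as an input clause.
      · push Not at hbad
        obtain ⟨β, hβ, hβD⟩ := hbad
        obtain ⟨D, hD, hDβ⟩ := hα β fun v hv => by
          rw [Finset.mem_insert, not_or] at hv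
          rw [hβ v hv.2, Function.update_of_ne hv.1]
        have hDM : ∀ v ∈ Clause.vars D, v ∉ M := fun v hv hvM =>
          hβD D (Finset.mem_filter.mpr ⟨(Finset.mem_filter.mp hD).1, v, hv, hvM⟩) hDβ
        have hDB : Clause.vars D ⊆ insert a B := by
          intro u hu
          by_cases hua : u = a
          · exact hua ▸ Finset.mem_insert_self _ _
          · exact Finset.mem_insert_of_mem (mem_clauseFrontier.mpr
              ⟨⟨D, (Finset.mem_filter.mp hD).1, (Finset.mem_filter.mp hD).2, hu⟩,
                by simp [hua, hDM u hu]⟩)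
        refine ⟨(D, ∅), Finset.mem_union_right _ (Finset.mem_image_of_mem _ (Finset.mem_filter.mpr
          ⟨mem_clausesOver.mpr hDB, (Finset.mem_filter.mp hD).1⟩)), by simp, ?_, hDB⟩
        exact hDβ.congr fun v hv => (hβ v (hDM v hv)).symm
    have done : ∀ b : Bool, ∀ q ∈ S₁, q.2 ⊆ M → Falsifies (Function.update α a b) q.1 →
        Clause.vars q.1 ⊆ insert a B → (a, !b) ∉ q.1 →
        Falsifies α q.1 ∧ Clause.vars q.1 ⊆ B := by
      intro b q _ _ hqα hqB hab
      have hav : ∀ v ∈ Clause.vars q.1, v ≠ a := by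
        rintro v hv rfl
        obtain ⟨⟨v, c⟩, hp, rfl⟩ := Finset.mem_image.mp hv
        have := hqα _ hp
        simp only [Function.update_self] at this
        have hc : c = !b := by cases b <;> cases c <;> simp_all
        exact hab (hc ▸ hp)
      refine ⟨hqα.congr fun v hv => (Function.update_of_ne (hav v hv) _ _).symm, fun v hv => ?_⟩
      exact Finset.mem_of_mem_insert_of_ne (hqB hv) (hav v hv)
    obtain ⟨q₀, hq₀, hM₀, hα₀, hB₀⟩ := half false
    obtain ⟨q₁, hq₁, hM₁, hα₁, hB₁⟩ := half true
    -- A clause without the literal on `a` is already over `B` and falsified by α, and no resolution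
    -- is needed.
    by_cases h₀ : (a, true) ∈ q₀.1
    · by_cases h₁ : (a, false) ∈ q₁.1
      · let R : Clause V := q₀.1.erase (a, true) ∪ q₁.1.erase (a, false)
        have hR : Falsifies α R ∧ Clause.vars R ⊆ B := by
          have hcase : ∀ p ∈ R, p.1 ≠ a ∧ α p.1 ≠ p.2 ∧ p.1 ∈ insert a B := by
            intro p hp
            rcases Finset.mem_union.mp hp with hp | hp
            · obtain ⟨hne, hp'⟩ := Finset.mem_erase.mp hp
              have hpa : p.1 ≠ a := by
                rintro rfl
                have := hα₀ _ hp'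
                simp only [Function.update_self] at this
                exact hne (Prod.ext rfl (by simpa using this.symm))
              have := hα₀ _ hp'
              rw [Function.update_of_ne hpa] at this
              exact ⟨hpa, this, hB₀ (Clause.mem_vars hp')⟩
            · obtain ⟨hne, hp'⟩ := Finset.mem_erase.mp hp
              have hpa : p.1 ≠ a := by
                rintro rfl
                have := hα₁ _ hp'
                simp only [Function.update_self] at this
                exact hne (Prod.ext rfl (by simpa using this.symm))
              have := hα₁ _ hp'
              rw [Function.update_of_ne hpa] at this
              exact ⟨hpa, this, hB₁ (Clause.mem_vars hp')⟩
          refine ⟨fun p hp => (hcase p hp).2.1, fun v hv => ?_⟩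
          obtain ⟨p, hp, rfl⟩ := Finset.mem_image.mp hv
          exact Finset.mem_of_mem_insert_of_ne (hcase p hp).2.2 (hcase p hp).1
        refine ⟨(R, insert a M), Finset.mem_union_right _ (Finset.mem_filter.mpr
          ⟨Finset.mem_image_of_mem _ (mem_clausesOver.mpr hR.2), Or.inr ⟨a, q₀, hq₀, q₁, hq₁,
            fun h => ha (hM₀ h), fun h => ha (hM₁ h), hM₀.trans (Finset.subset_insert _ _),
            hM₁.trans (Finset.subset_insert _ _), Finset.mem_insert_self _ _, h₀, h₁, rfl⟩⟩),
          subset_rfl, hR⟩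
      · exact ⟨q₁, Finset.mem_union_left _ hq₁, hM₁.trans (Finset.subset_insert _ _),
          done true q₁ hq₁ hM₁ hα₁ hB₁ h₁⟩
    · exact ⟨q₀, Finset.mem_union_left _ hq₀, hM₀.trans (Finset.subset_insert _ _),
        done false q₀ hq₀ hM₀ hα₀ hB₀ h₀⟩
  · intro q hq
    rcases Finset.mem_union.mp hq with hq | hq
    · rcases Finset.mem_union.mp hq with hq | hq
      · exact (hSM q hq).trans (Finset.subset_insert _ _)
      · obtain ⟨C, hC, rfl⟩ := Finset.mem_image.mp hq
        simp
    · obtain ⟨C, hC, rfl⟩ := Finset.mem_image.mp (Finset.mem_filter.mp hq).1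
      simp
  · have h1 : (((clausesOver (insert a B)).filter (· ∈ ψ)).image
        fun C => (C, (∅ : Finset V))).card ≤ 4 ^ (w + 1) :=
      Finset.card_image_le.trans ((Finset.card_filter_le _ _).trans (by
        rw [card_clausesOver]; exact Nat.pow_le_pow_right (by norm_num) hcB))
    have h2 : S₂.card ≤ 4 ^ (w + 1) :=
      (Finset.card_filter_le _ _).trans (Finset.card_image_le.trans (by
        rw [card_clausesOver]; exact Nat.pow_le_pow_right (by norm_num) (by omega)))
    have h3 : S₁.card ≤ S.card + _ := Finset.card_union_le _ _
    have h4 : (S₁ ∪ S₂).card ≤ S₁.card + S₂.card := Finset.card_union_le _ _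
    omega

/-- Elimination of all variables but those of `E`, in the order of the end points of their intervals
`[s v, τ v]`, if the intervals of any two variables of a clause intersect.  The variables of `Z` are
available at all times. -/
theorem exists_eliminates {φ ψ : Finset (Clause V)} (hψ : ψ ⊆ φ) (W Z E : Finset V) (s τ : V → ℤ)
    (hvars : ∀ D ∈ ψ, Clause.vars D ⊆ W ∪ Z) (hE : E ⊆ Z)
    (hcompat : ∀ D ∈ ψ, ∀ u ∈ Clause.vars D, ∀ v ∈ Clause.vars D, u ∉ Z → v ∉ Z → s u ≤ τ v)
    {w : ℕ} (hw : ∀ t : ℤ, (W.filter fun v => s v ≤ t ∧ t ≤ τ v).card + Z.card ≤ w) :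
    ∃ S : Finset (Clause V × Finset V), IsDerivation φ S ∧ Eliminates ψ S ((W ∪ Z) \ E) ∧
      (∀ q ∈ S, q.2 ⊆ (W ∪ Z) \ E) ∧ S.card ≤ (W ∪ Z).card * (2 * 4 ^ (w + 1)) := by
  classical
  set U := (W ∪ Z) \ E with hUdef
  -- The value ⊤ postpones the variables of `Z` until all others are gone. The eliminated set `M` is
  -- always downward closed for `f`.
  let f : V → WithTop ℤ := fun v => if v ∈ Z then ⊤ else (τ v : WithTop ℤ)
  have main : ∀ M : Finset V, (M ⊆ U ∧ ∀ x ∈ M, ∀ y ∈ U, f y < f x → y ∈ M) →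
      ∃ S : Finset (Clause V × Finset V), IsDerivation φ S ∧ Eliminates ψ S M ∧
        (∀ q ∈ S, q.2 ⊆ M) ∧ S.card ≤ M.card * (2 * 4 ^ (w + 1)) := by
    intro M
    induction M using Finset.induction_on_max_value f with
    | empty =>
      intro _
      refine ⟨∅, by simp [IsDerivation], fun α hα => ?_, by simp, by simp⟩
      obtain ⟨D, hD, -⟩ := hα α fun _ _ => rfl
      simp [touching] at hD
    | insert a M ha hmax ih =>
      rintro ⟨hMU, hdown⟩
      obtain ⟨S, hS, hSE, hSM, hcard⟩ := ih ⟨(Finset.subset_insert _ _).trans hMU,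
        fun x hx y hy hyx => Finset.mem_of_mem_insert_of_ne
          (hdown x (Finset.mem_insert_of_mem hx) y hy hyx)
          (by rintro rfl; exact absurd hyx (not_lt.mpr (hmax x hx)))⟩
      -- A frontier variable u outside `Z` is not yet eliminated, so τ a ≤ τ u. It shares a clause
      -- with an eliminated v, so s u ≤ τ v ≤ τ a. Hence u is live at time τ a.
      have hfront : clauseFrontier ψ (insert a M) ⊆
          (W.filter fun v => s v ≤ τ a ∧ τ a ≤ τ v) ∪ Z := by
        intro u hu
        obtain ⟨⟨D, hD, ⟨v, hv, hvM⟩, huD⟩, huM⟩ := mem_clauseFrontier.mp hu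
        by_cases huZ : u ∈ Z
        · exact Finset.mem_union_right _ huZ
        have huWZ := hvars D hD huD
        have huW : u ∈ W := (Finset.mem_union.mp huWZ).resolve_right huZ
        have huU : u ∈ U := Finset.mem_sdiff.mpr ⟨huWZ, fun h => huZ (hE h)⟩
        have hlt : ∀ x ∈ insert a M, f x ≤ f u := fun x hx =>
          not_lt.mp fun h => huM (hdown x hx u huU h)
        have hZ : ∀ x ∈ insert a M, x ∉ Z := by
          intro x hx hxZ
          have := hlt x hx
          simp [f, huZ, hxZ] at this
        have haM := Finset.mem_insert_self a M
        have hva : f v ≤ f a := by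
          rcases Finset.mem_insert.mp hvM with rfl | h
          · exact le_rfl
          · exact hmax v h
        have hau := hlt a haM
        simp only [f, hZ _ haM, hZ _ hvM, huZ, if_false, WithTop.coe_le_coe] at hva hau
        exact Finset.mem_union_left _ (Finset.mem_filter.mpr
          ⟨huW, (hcompat D hD u huD v hv huZ (hZ v hvM)).trans hva, hau⟩)
      have hfw := (Finset.card_le_card hfront).trans ((Finset.card_union_le _ _).trans (hw (τ a)))
      obtain ⟨S', h1, h2, h3, h4⟩ := hSE.exists_insert hψ hS hSM ha hfw
      refine ⟨S', h1, h2, h3, ?_⟩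
      rw [Finset.card_insert_of_notMem ha, add_mul, one_mul]
      omega
  obtain ⟨S, h1, h2, h3, h4⟩ := main U ⟨subset_rfl, fun _ _ y hy _ => hy⟩
  exact ⟨S, h1, h2, h3, h4.trans (Nat.mul_le_mul_right _ (Finset.card_le_card Finset.sdiff_subset))⟩

/-- If `ψ` cannot be satisfied by an extension of `α` on `E`, then a clause over `E` falsified by `α`
has a short derivation. -/
theorem exists_derivation_over {φ ψ : Finset (Clause V)} (hψ : ψ ⊆ φ) (W Z E : Finset V)
    (s τ : V → ℤ) (hvars : ∀ D ∈ ψ, Clause.vars D ⊆ W ∪ Z) (hE : E ⊆ Z)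
    (htouch : ∀ D ∈ ψ, ∃ v ∈ Clause.vars D, v ∉ E)
    (hcompat : ∀ D ∈ ψ, ∀ u ∈ Clause.vars D, ∀ v ∈ Clause.vars D, u ∉ Z → v ∉ Z → s u ≤ τ v)
    {w : ℕ} (hw : ∀ t : ℤ, (W.filter fun v => s v ≤ t ∧ t ≤ τ v).card + Z.card ≤ w)
    {α : V → Bool}
    (hα : ∀ β : V → Bool, (∀ v ∈ E, β v = α v) → ∃ D ∈ ψ, Falsifies β D) :
    ∃ S : Finset (Clause V × Finset V), IsDerivation φ S ∧
      (∃ q ∈ S, Falsifies α q.1 ∧ Clause.vars q.1 ⊆ E) ∧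
      (∀ q ∈ S, q.2 ⊆ (W ∪ Z) \ E) ∧ S.card ≤ (W ∪ Z).card * (2 * 4 ^ (w + 1)) := by
  obtain ⟨S, h1, h2, h3, h4⟩ := exists_eliminates hψ W Z E s τ hvars hE hcompat hw
  refine ⟨S, h1, ?_, h3, h4⟩
  obtain ⟨q, hq, -, hqα, hqv⟩ := h2 α fun β hβ => by
    obtain ⟨D, hD, hDβ⟩ := hα β fun v hv => hβ v fun h => (Finset.mem_sdiff.mp h).2 hv
    obtain ⟨v, hv, hvE⟩ := htouch D hD
    exact ⟨D, Finset.mem_filter.mpr ⟨hD, v, hv, Finset.mem_sdiff.mpr ⟨hvars D hD hv, hvE⟩⟩, hDβ⟩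
  refine ⟨q, hq, hqα, fun u hu => ?_⟩
  obtain ⟨⟨D, hD, -, huD⟩, hu⟩ := mem_clauseFrontier.mp (hqv hu)
  by_contra huE
  exact hu (Finset.mem_sdiff.mpr ⟨hvars D hD huD, huE⟩)

end Elimination

namespace Wallace

/-! ## Shape of the tableau -/

theorem height_succ {n i : ℕ} (l : ℕ) (hi : i < 2 * n) :
    height n (l + 1) i = numSums (height n l i) + carriesInto n l i := by
  cases i with
  | zero =>
    have hn : 0 < n := by omega
    simp [height, carriesInto, hn]
  | succ i => simp [height, carriesInto, hi]

theorem height_col_zero {n : ℕ} (hn : 0 < n) (l : ℕ) : height n l 0 = 1 := by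
  induction l with
  | zero => simp [height, hn]
  | succ l ih => simp [height, hn, ih, numSums]

/-- The bound 2 reproduces itself: columns differing by at most 2 have numbers of sums, and of
carries, differing by at most 1, and a new column is one of each. -/
theorem height_adjacent {n : ℕ} (l i : ℕ) (hi : i + 1 < 2 * n) :
    height n l (i + 1) ≤ height n l i + 2 ∧ height n l i ≤ height n l (i + 1) + 2 := by
  induction l generalizing i with
  | zero => simp only [height]; split <;> split <;> omega
  | succ l ih =>
    rw [height_succ l hi, height_succ l (by omega : i < 2 * n)]
    have h1 := ih i hi
    cases i with
    | zero =>
      have h0 := height_col_zero (by omega : 0 < n) l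
      simp only [carriesInto, numSums, numCarries, zero_add] at *
      omega
    | succ i =>
      have h2 := ih i (by omega)
      simp only [carriesInto, numSums, numCarries] at *
      omega

/-- This makes sum-bits and carry-bits alternate in each column of the next layer, so that the
outputs of the j-th adders stand at positions 2j and 2j+1. -/
theorem numSums_le_carriesInto {n l i : ℕ} (hi : i < 2 * n) :
    numSums (height n l i) ≤ carriesInto n l i + 1 ∧
      carriesInto n l i ≤ numSums (height n l i) + 1 := by
  cases i with
  | zero =>
    have h0 := height_col_zero (by omega : 0 < n) l
    simp only [carriesInto, numSums, h0]
    omega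
  | succ i =>
    have h := height_adjacent l i hi
    simp only [carriesInto, numSums, numCarries]
    omega

theorem sumPos_eq {n l i j : ℕ} (hi : i < 2 * n) (hj : j < numSums (height n l i)) :
    sumPos n l i j = 2 * j := by
  have := numSums_le_carriesInto (l := l) hi
  simp only [sumPos]
  omega

/-- The position is 2j+1, or 2j if the sum-bits have run out. -/
theorem carryPos_div_two {n l i j : ℕ} (hi : i + 1 < 2 * n) (hj : j < numCarries (height n l i)) :
    carryPos n l i j / 2 = j := by
  have := numSums_le_carriesInto (l := l) hi
  simp only [carriesInto] at this
  simp only [carryPos]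
  omega

/-! ### Splitting the sum over a column into sum-bits and carry-bits -/

theorem sum_range_two_mul (f : ℕ → ℕ) (m : ℕ) :
    ∑ r ∈ Finset.range (2 * m), f r =
      ∑ j ∈ Finset.range m, f (2 * j) + ∑ j ∈ Finset.range m, f (2 * j + 1) := by
  induction m with
  | zero => simp
  | succ m ih =>
    rw [show 2 * (m + 1) = 2 * m + 1 + 1 by ring, Finset.sum_range_succ, Finset.sum_range_succ, ih,
      Finset.sum_range_succ, Finset.sum_range_succ]
    ring

/-- The outputs fill the column without gap or collision: sums at even places, carries at odd ones,
except that for c = S + 1 the last carry takes the even place 2S. -/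
theorem sum_range_interleave (f : ℕ → ℕ) {S c : ℕ} (h1 : S ≤ c + 1) (h2 : c ≤ S + 1) :
    ∑ r ∈ Finset.range (S + c), f r =
      ∑ j ∈ Finset.range S, f (j + min j c) + ∑ j ∈ Finset.range c, f (min (j + 1) S + j) := by
  have e1 : ∑ j ∈ Finset.range S, f (j + min j c) = ∑ j ∈ Finset.range S, f (2 * j) :=
    Finset.sum_congr rfl fun j hj => by
      have := Finset.mem_range.mp hj
      congr 1; omega
  rw [e1]
  by_cases h : c ≤ S
  · have e2 : ∑ j ∈ Finset.range c, f (min (j + 1) S + j) =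
        ∑ j ∈ Finset.range c, f (2 * j + 1) :=
      Finset.sum_congr rfl fun j hj => by
        have := Finset.mem_range.mp hj
        congr 1; omega
    rw [e2]
    obtain rfl | rfl : S = c ∨ S = c + 1 := by omega
    · rw [← two_mul, sum_range_two_mul]
    · rw [show c + 1 + c = 2 * c + 1 by ring, Finset.sum_range_succ, sum_range_two_mul,
        Finset.sum_range_succ]
      ring
  · obtain rfl : c = S + 1 := by omega
    have e2 : ∑ j ∈ Finset.range S, f (min (j + 1) S + j) =
        ∑ j ∈ Finset.range S, f (2 * j + 1) :=
      Finset.sum_congr rfl fun j hj => by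
        have := Finset.mem_range.mp hj
        congr 1; omega
    rw [Finset.sum_range_succ, e2, show S + (S + 1) = 2 * S + 1 by ring, Finset.sum_range_succ,
      sum_range_two_mul, show min (S + 1) S + S = 2 * S by omega]
    ring

theorem sum_layer_succ_zero {n : ℕ} (hn : 0 < n) (l : ℕ) (f : ℕ → ℕ) :
    ∑ r ∈ Finset.range (height n (l + 1) 0), f r =
      ∑ j ∈ Finset.range (numSums (height n l 0)), f (sumPos n l 0 j) := by
  have hi : 0 < 2 * n := by omega
  have h := numSums_le_carriesInto (l := l) hi
  rw [height_succ l hi, sum_range_interleave f h.1 h.2]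
  simp [sumPos, carriesInto]

theorem sum_layer_succ {n l i : ℕ} (hi : i + 1 < 2 * n) (f : ℕ → ℕ) :
    ∑ r ∈ Finset.range (height n (l + 1) (i + 1)), f r =
      ∑ j ∈ Finset.range (numSums (height n l (i + 1))), f (sumPos n l (i + 1) j) +
        ∑ j ∈ Finset.range (numCarries (height n l i)), f (carryPos n l i j) := by
  have h := numSums_le_carriesInto (l := l) hi
  rw [height_succ l hi, sum_range_interleave f h.1 h.2]
  rfl

/-! ### Bounds for the heights and for the number of layers -/

theorem height_le (n l i : ℕ) (hn : 2 ≤ n) : height n l i ≤ n := by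
  have := height_le_sub n l i
  omega

/-- This is height ≤ (2/3)^l n + 3 without denominators. The 3 is the fixed point of h ↦ (2h + 3)/3,
which bounds the effect of one layer. -/
theorem pow_mul_height_le {n : ℕ} (l i : ℕ) : 3 ^ l * height n l i ≤ 2 ^ l * n + 3 * 3 ^ l := by
  induction l generalizing i with
  | zero => simp only [height]; split <;> omega
  | succ l ih =>
    have h1 := ih i
    have key : ∀ a b : ℕ, 3 ^ l * a ≤ 2 ^ l * n + 3 * 3 ^ l → 3 ^ l * b ≤ 2 ^ l * n + 3 * 3 ^ l →
        3 ^ (l + 1) * (numSums a + numCarries b) ≤ 2 ^ (l + 1) * n + 3 * 3 ^ (l + 1) := by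
      intro a b ha hb
      have h : 3 * (numSums a + numCarries b) ≤ a + b + 3 := by
        simp only [numSums, numCarries]; omega
      calc 3 ^ (l + 1) * (numSums a + numCarries b)
          = 3 ^ l * (3 * (numSums a + numCarries b)) := by ring
        _ ≤ 3 ^ l * (a + b + 3) := Nat.mul_le_mul_left _ h
        _ = 3 ^ l * a + 3 ^ l * b + 3 * 3 ^ l := by ring
        _ ≤ _ := by rw [pow_succ, pow_succ]; nlinarith
    by_cases hi : i < 2 * n
    · rw [height_succ l hi]
      cases i with
      | zero => exact key _ 0 h1 (by simp)
      | succ i => exact key _ _ h1 (ih i)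
    · have : height n (l + 1) i = 0 := by
        cases i with
        | zero => have : n = 0 := by omega
                  simp [height, this]
        | succ i => simp [height, hi]
      simp [this]

/-- After 2 log n + 2 layers (2/3)^l n < 1, because 4^(L+1) n < 8^(L+1) ≤ 9^(L+1). Then heights are
at most 3, and one more layer leaves one sum and one carry per column. -/
theorem lastLayer_le {n : ℕ} : lastLayer n ≤ 2 * Nat.log 2 n + 3 := by
  apply Nat.find_min'
  intro i hi
  have h3 : ∀ i, height n (2 * Nat.log 2 n + 2) i ≤ 3 := by
    intro i
    have h := pow_mul_height_le (n := n) (2 * Nat.log 2 n + 2) i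
    have hn : n < 2 ^ (Nat.log 2 n + 1) := Nat.lt_pow_succ_log_self (by norm_num) n
    have h8 : 2 ^ (2 * Nat.log 2 n + 2) * n < 3 ^ (2 * Nat.log 2 n + 2) := by
      have e2 : 2 ^ (2 * Nat.log 2 n + 2) = 4 ^ (Nat.log 2 n + 1) := by
        rw [show 2 * Nat.log 2 n + 2 = 2 * (Nat.log 2 n + 1) by ring, pow_mul]; norm_num
      have e3 : 3 ^ (2 * Nat.log 2 n + 2) = 9 ^ (Nat.log 2 n + 1) := by
        rw [show 2 * Nat.log 2 n + 2 = 2 * (Nat.log 2 n + 1) by ring, pow_mul]; norm_num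
      rw [e2, e3]
      calc 4 ^ (Nat.log 2 n + 1) * n < 4 ^ (Nat.log 2 n + 1) * 2 ^ (Nat.log 2 n + 1) :=
            Nat.mul_lt_mul_of_pos_left hn (by positivity)
        _ = 8 ^ (Nat.log 2 n + 1) := by rw [← mul_pow]; norm_num
        _ ≤ 9 ^ (Nat.log 2 n + 1) := Nat.pow_le_pow_left (by norm_num) _
    by_contra h4
    have : 3 ^ (2 * Nat.log 2 n + 2) * 4 ≤ 3 ^ (2 * Nat.log 2 n + 2) *
      height n (2 * Nat.log 2 n + 2) i := Nat.mul_le_mul_left _ (by omega)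
    omega
  rw [height_succ _ hi]
  have := h3 i
  cases i with
  | zero => simp only [carriesInto, numSums]; omega
  | succ i =>
    have := h3 i
    simp only [carriesInto, numSums, numCarries]; omega

theorem height_lastLayer {n i : ℕ} (hi : i < 2 * n) : height n (lastLayer n) i ≤ 2 :=
  Nat.find_spec (exists_two_rows n) i hi

theorem lastLayer_le_self (n : ℕ) : lastLayer n ≤ n :=
  Nat.find_min' _ fun i _ => by have := height_le_sub n n i; omega

/-! ## A schedule for the cells of the tableau -/

/-- The time at which the cells at position `r` of layer `l` become known, if the partial products
of row `r` become known at time `r`. -/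
def birth : ℕ → ℕ → ℕ
  | 0, r => r
  | l + 1, r => birth l (3 * (r / 2) + 2)

theorem birth_mono (l : ℕ) : Monotone (birth l) := by
  induction l with
  | zero => exact monotone_id
  | succ l ih => intro a b h; exact ih (by omega)

theorem birth_lt_birth_add_two (l r : ℕ) : birth l r < birth l (r + 2) := by
  induction l generalizing r with
  | zero => simp [birth]
  | succ l ih =>
    simp only [birth]
    exact (ih _).trans_le (birth_mono l (by omega))

/-- At most four cells of a column of a layer are in use at the same time. -/
theorem card_alive_le (l N : ℕ) (t : ℤ) :
    ((Finset.range N).filter fun r => (birth l r : ℤ) ≤ t ∧ t ≤ birth l (r + 2)).card ≤ 4 := by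
  rcases Finset.eq_empty_or_nonempty
    ((Finset.range N).filter fun r => (birth l r : ℤ) ≤ t ∧ t ≤ birth l (r + 2)) with h | h
  · simp [h]
  · obtain ⟨r₀, hr₀, hmin⟩ := Finset.exists_min_image _ id h
    -- If `r₀` is the first live cell, a cell at `r₀ + 4` or beyond is born after `birth l (r₀ +
    -- 2)`, that is, after time t.
    have hsub : ((Finset.range N).filter fun r => (birth l r : ℤ) ≤ t ∧ t ≤ birth l (r + 2)) ⊆
        Finset.Ico r₀ (r₀ + 4) := by
      intro r hr
      rw [Finset.mem_Ico]
      refine ⟨hmin r hr, ?_⟩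
      by_contra hlt
      have h1 := (Finset.mem_filter.mp hr).2.1
      have h2 := (Finset.mem_filter.mp hr₀).2.2
      have h3 := birth_lt_birth_add_two l (r₀ + 2)
      have h4 := birth_mono l (show r₀ + 2 + 2 ≤ r by omega)
      omega
    simpa using Finset.card_le_card hsub

/-! ## Arithmetic of a strip -/

/-- Adding with carries, column by column. -/
theorem sum_add_carry (A B c : ℕ → ℕ) (w : ℕ) (h : ∀ d < w, A d + c d = B d + 2 * c (d + 1)) :
    ∑ d ∈ Finset.range w, 2 ^ d * A d + c 0 = ∑ d ∈ Finset.range w, 2 ^ d * B d + 2 ^ w * c w := by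
  induction w with
  | zero => simp
  | succ w ih =>
    have h1 := ih fun d hd => h d (by omega)
    have h2 := h w (by omega)
    rw [Finset.sum_range_succ, Finset.sum_range_succ, pow_succ]
    have : 2 ^ w * A w + 2 ^ w * c w = 2 ^ w * B w + 2 ^ w * (2 * c (w + 1)) := by
      rw [← mul_add, h2, mul_add]
    linarith

theorem sum_add_carry_modEq (A B c : ℕ → ℕ) (w : ℕ)
    (h : ∀ d < w, A d + c d = B d + 2 * c (d + 1)) :
    ∑ d ∈ Finset.range w, 2 ^ d * A d + c 0 ≡ ∑ d ∈ Finset.range w, 2 ^ d * B d [MOD 2 ^ w] := by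
  rw [sum_add_carry A B c w h]
  simp [Nat.ModEq]

/-- Two sums with small carry-ins whose low bits agree have the same next bit. -/
theorem strip_contradiction {w P Q₁ Q₂ : ℕ} {o₁ o₂ : ℕ → ℕ}
    (h₁ : P + Q₁ ≡ ∑ d ∈ Finset.range (w + 1), 2 ^ d * o₁ d [MOD 2 ^ (w + 1)])
    (h₂ : P + Q₂ ≡ ∑ d ∈ Finset.range (w + 1), 2 ^ d * o₂ d [MOD 2 ^ (w + 1)])
    (hQ₁ : Q₁ < 2 ^ w) (hQ₂ : Q₂ < 2 ^ w) (heq : ∀ d < w, o₁ d = o₂ d)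
    (hne : o₁ w = 0 ∧ o₂ w = 1 ∨ o₁ w = 1 ∧ o₂ w = 0) : False := by
  rw [Finset.sum_range_succ] at h₁ h₂
  rw [Finset.sum_congr rfl fun d hd => by rw [heq d (Finset.mem_range.mp hd)]] at h₁
  rw [← Int.natCast_modEq_iff, Int.modEq_iff_dvd] at h₁ h₂
  obtain ⟨a, ha⟩ := h₁
  obtain ⟨b, hb⟩ := h₂
  push_cast at ha hb
  have hw : (0 : ℤ) < 2 ^ w := by positivity
  have hQ₁' : (Q₁ : ℤ) < 2 ^ w := by exact_mod_cast hQ₁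
  have hQ₂' : (Q₂ : ℤ) < 2 ^ w := by exact_mod_cast hQ₂
  rw [pow_succ] at ha hb
  generalize (2 : ℤ) ^ w = m at *
  generalize ∑ d ∈ Finset.range w, (2 : ℤ) ^ d * (o₂ d : ℤ) = s at *
  -- Both carry-ins lie in [0, m), so their difference is a multiple of m only if it is 0. The
  -- quotients met below are odd.
  have key : ∀ k : ℤ, (Q₁ : ℤ) - Q₂ = m * k → k = 0 := by
    intro k hk
    have h1 : m * k < m * 1 := by linarith [Int.natCast_nonneg Q₂]
    have h2 : m * (-1) < m * k := by linarith [Int.natCast_nonneg Q₁]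
    have h3 := lt_of_mul_lt_mul_left h1 hw.le
    have h4 := lt_of_mul_lt_mul_left h2 hw.le
    omega
  rcases hne with ⟨e₁, e₂⟩ | ⟨e₁, e₂⟩ <;> rw [e₁] at ha <;> rw [e₂] at hb <;> push_cast at ha hb
  · have := key (-1 - 2 * (a - b)) (by linarith)
    omega
  · have := key (1 - 2 * (a - b)) (by linarith)
    omega

end Wallace

/-! ## Semantics of gates -/

section Gates

variable {V : Type} [DecidableEq V]

/-- The value of an input of a gate. -/
def inputValue (α : V → Bool) : Option V → Bool
  | none => false
  | some v => α v

/-- The assignment `α` satisfies the constraint `z = f (ins 0, …, ins (k-1))`. -/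
def GateHolds (α : V → Bool) (z : V) {k : ℕ} (ins : Fin k → Option V)
    (f : (Fin k → Bool) → Bool) : Prop :=
  α z = f fun s => inputValue α (ins s)

/-- No clause of `Γ` is falsified by `α`. -/
def Models (α : V → Bool) (Γ : Finset (Clause V)) : Prop := ∀ D ∈ Γ, ¬ Falsifies α D

theorem Models.mono {X : Type} {α : X → Bool} {Γ Γ' : Finset (Clause X)} (h : Models α Γ) (hΓ : Γ' ⊆ Γ) :
    Models α Γ' := fun D hD => h D (hΓ hD)

theorem Models.gateHolds {α : V → Bool} {z : V} {k : ℕ} {ins : Fin k → Option V}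
    {f : (Fin k → Bool) → Bool} (h : Models α (gate z ins f)) : GateHolds α z ins f := by
  by_contra hz
  refine h _ (Finset.mem_image_of_mem _ (Finset.mem_filter.mpr ⟨Finset.mem_univ
    (fun s => inputValue α (ins s)), fun s hs => by simp [hs, inputValue]⟩)) ?_
  intro p hp
  rcases Finset.mem_insert.mp hp with rfl | hp
  · exact hz
  · obtain ⟨s, -, hs⟩ := Finset.mem_biUnion.mp hp
    cases hi : ins s with
    | none => simp [hi] at hs
    | some v =>
      simp only [hi, Finset.mem_singleton] at hs
      subst hs
      simp [inputValue]

theorem mem_vars_of_mem_gate {z : V} {k : ℕ} {ins : Fin k → Option V}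
    {f : (Fin k → Bool) → Bool} {D : Clause V} (hD : D ∈ gate z ins f) {u : V}
    (hu : u ∈ Clause.vars D) : u = z ∨ ∃ s, ins s = some u := by
  obtain ⟨a, -, rfl⟩ := Finset.mem_image.mp hD
  obtain ⟨p, hp, rfl⟩ := Finset.mem_image.mp hu
  rcases Finset.mem_insert.mp hp with rfl | hp
  · exact Or.inl rfl
  · obtain ⟨s, -, hs⟩ := Finset.mem_biUnion.mp hp
    cases hi : ins s with
    | none => simp [hi] at hs
    | some v =>
      simp only [hi, Finset.mem_singleton] at hs
      subst hs
      exact Or.inr ⟨s, hi⟩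

theorem input_mem_vars_of_mem_gate {z : V} {k : ℕ} {ins : Fin k → Option V}
    {f : (Fin k → Bool) → Bool} {D : Clause V} (hD : D ∈ gate z ins f) {u : V} {s : Fin k}
    (hs : ins s = some u) : u ∈ Clause.vars D := by
  obtain ⟨a, -, rfl⟩ := Finset.mem_image.mp hD
  refine Finset.mem_image.mpr ⟨(u, !a s), Finset.mem_insert_of_mem
    (Finset.mem_biUnion.mpr ⟨s, Finset.mem_univ _, ?_⟩), rfl⟩
  simp [hs]

theorem output_mem_vars_of_mem_gate {z : V} {k : ℕ} {ins : Fin k → Option V}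
    {f : (Fin k → Bool) → Bool} {D : Clause V} (hD : D ∈ gate z ins f) : z ∈ Clause.vars D := by
  obtain ⟨a, -, rfl⟩ := Finset.mem_image.mp hD
  exact Finset.mem_image.mpr ⟨(z, f a), Finset.mem_insert_self _ _, rfl⟩

end Gates

namespace Wallace

/-! ## Arithmetic of the adders -/

theorem sum_range_three_mul (f : ℕ → ℕ) (m : ℕ) :
    ∑ r ∈ Finset.range (3 * m), f r =
      ∑ j ∈ Finset.range m, (f (3 * j) + f (3 * j + 1) + f (3 * j + 2)) := by
  induction m with
  | zero => simp
  | succ m ih =>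
    rw [show 3 * (m + 1) = 3 * m + 1 + 1 + 1 by ring, Finset.sum_range_succ, Finset.sum_range_succ,
      Finset.sum_range_succ, ih, Finset.sum_range_succ]
    ring

/-- Each adder preserves value: a + b + c = xor + 2 maj. The column is padded with zeros to full
groups of three. -/
theorem sum_column (n : ℕ) (C : Side) (l i : ℕ) (α : WVar → Bool) :
    ∑ r ∈ Finset.range (height n l i), (α (.t C l i r)).toNat =
      ∑ j ∈ Finset.range (numSums (height n l i)),
          (xor3 fun s => inputValue α (adderInputs n C l i j s)).toNat +
        2 * ∑ j ∈ Finset.range (numCarries (height n l i)),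
          (maj3 fun s => inputValue α (adderInputs n C l i j s)).toNat := by
  set H := height n l i with hH
  let F : ℕ → Bool := fun r => inputValue α (cell n C l i r)
  have hF : ∀ r, H ≤ r → F r = false := fun r hr => by
    simp [F, cell, inputValue, not_lt.mpr hr, ← hH]
  have hF' : ∀ r, r < H → F r = α (.t C l i r) := fun r hr => by
    simp [F, cell, inputValue, hr, ← hH]
  have e1 : ∑ r ∈ Finset.range H, (α (.t C l i r)).toNat =
      ∑ r ∈ Finset.range (3 * numSums H), (F r).toNat := by
    rw [Finset.sum_congr rfl fun r hr => by rw [← hF' r (Finset.mem_range.mp hr)]]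
    refine Finset.sum_subset (Finset.range_subset_range.mpr (by simp only [numSums]; omega)) ?_
    intro r _ hr
    rw [hF r (by simpa using hr)]; rfl
  -- The two ranges differ at most by a final wire, whose majority is 0.
  have e2 : ∑ j ∈ Finset.range (numCarries H),
      (maj3 fun s => inputValue α (adderInputs n C l i j s)).toNat =
      ∑ j ∈ Finset.range (numSums H),
      (maj3 fun s => inputValue α (adderInputs n C l i j s)).toNat := by
    refine Finset.sum_subset (Finset.range_subset_range.mpr
      (by simp only [numSums, numCarries]; omega)) ?_
    intro j _ hj
    have hj' : numCarries H ≤ j := by simpa using hj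
    simp only [numCarries] at hj'
    change ((F (3 * j) && F (3 * j + 1)) || (F (3 * j) && F (3 * j + 2)) ||
      (F (3 * j + 1) && F (3 * j + 2))).toNat = 0
    rw [hF (3 * j + 1) (by omega), hF (3 * j + 2) (by omega)]
    simp
  rw [e1, e2, sum_range_three_mul, Finset.mul_sum, ← Finset.sum_add_distrib]
  refine Finset.sum_congr rfl fun j _ => ?_
  change _ = (F (3 * j) ^^ F (3 * j + 1) ^^ F (3 * j + 2)).toNat + 2 *
    ((F (3 * j) && F (3 * j + 1)) || (F (3 * j) && F (3 * j + 2)) ||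
      (F (3 * j + 1) && F (3 * j + 2))).toNat
  generalize F (3 * j) = a, F (3 * j + 1) = b, F (3 * j + 2) = c
  revert a b c
  decide

/-! ## The carry-lookahead adder -/

/-- The lookahead formulas are the ripple rule c' = g ⊕ cp expanded over the field with two
elements, so no relation between generate and propagate bits is needed. -/
theorem claUnit_carry {α : WVar → Bool} {C : Side} {l k : ℕ} (h : Models α (claUnit C l k))
    {s : ℕ} (hs : s < 3) :
    α (.c C (4 ^ l * (4 * k + (s + 1)))) = (α (.g C l (4 * k + s)) ^^
      (inputValue α (carry C (4 ^ l * (4 * k + s))) && α (.p C l (4 * k + s)))) := by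
  simp only [claUnit] at h
  have h1 := (h.mono ((Finset.subset_union_left.trans Finset.subset_union_left).trans
    (Finset.subset_union_left.trans Finset.subset_union_left))).gateHolds
  have h2 := (h.mono ((Finset.subset_union_right.trans Finset.subset_union_left).trans
    (Finset.subset_union_left.trans Finset.subset_union_left))).gateHolds
  have h3 := (h.mono (Finset.subset_union_right.trans
    (Finset.subset_union_left.trans Finset.subset_union_left))).gateHolds
  have hc : ∀ s, inputValue α (carry C (4 ^ l * (4 * k + (s + 1)))) =
      α (.c C (4 ^ l * (4 * k + (s + 1)))) := fun s => by
    rw [carry, if_neg (by positivity)]; rfl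
  obtain rfl | rfl | rfl : s = 0 ∨ s = 1 ∨ s = 2 := by omega
  · exact h1
  · rw [hc 0, zero_add]
    refine h2.trans (Eq.trans ?_ (congrArg (fun b => α (.g C l (4 * k + 1)) ^^
      (b && α (.p C l (4 * k + 1)))) h1.symm))
    change (α (.g C l (4 * k + 1)) ^^ (α (.g C l (4 * k + 0)) && α (.p C l (4 * k + 1))) ^^
      (inputValue α (carry C (4 ^ l * (4 * k))) && α (.p C l (4 * k + 0)) &&
        α (.p C l (4 * k + 1)))) = (α (.g C l (4 * k + 1)) ^^ ((α (.g C l (4 * k + 0)) ^^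
      (inputValue α (carry C (4 ^ l * (4 * k))) && α (.p C l (4 * k + 0)))) &&
        α (.p C l (4 * k + 1))))
    generalize α (.g C l (4 * k + 1)) = a, α (.g C l (4 * k + 0)) = b,
      α (.p C l (4 * k + 1)) = c, α (.p C l (4 * k + 0)) = d,
      inputValue α (carry C (4 ^ l * (4 * k))) = e
    revert a b c d e
    decide
  · rw [hc 1]
    refine h3.trans (Eq.trans ?_ (congrArg (fun b => α (.g C l (4 * k + 2)) ^^
      (b && α (.p C l (4 * k + 2)))) h2.symm))
    change (α (.g C l (4 * k + 2)) ^^ (α (.g C l (4 * k + 1)) && α (.p C l (4 * k + 2))) ^^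
      (α (.g C l (4 * k + 0)) && α (.p C l (4 * k + 1)) && α (.p C l (4 * k + 2))) ^^
      (inputValue α (carry C (4 ^ l * (4 * k))) && α (.p C l (4 * k + 0)) &&
        α (.p C l (4 * k + 1)) && α (.p C l (4 * k + 2)))) =
      (α (.g C l (4 * k + 2)) ^^ ((α (.g C l (4 * k + 1)) ^^
        (α (.g C l (4 * k + 0)) && α (.p C l (4 * k + 1))) ^^
      (inputValue α (carry C (4 ^ l * (4 * k))) && α (.p C l (4 * k + 0)) &&
        α (.p C l (4 * k + 1)))) && α (.p C l (4 * k + 2))))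
    generalize α (.g C l (4 * k + 1)) = a, α (.g C l (4 * k + 0)) = b,
      α (.p C l (4 * k + 1)) = c, α (.p C l (4 * k + 0)) = d,
      inputValue α (carry C (4 ^ l * (4 * k))) = e, α (.g C l (4 * k + 2)) = a',
      α (.p C l (4 * k + 2)) = c'
    revert a b c d e a' c'
    decide

/-- The carry out of a unit is the carry out of its last subblock. -/
theorem claUnit_group {α : WVar → Bool} {C : Side} {l k : ℕ} (h : Models α (claUnit C l k)) :
    (α (.g C (l + 1) k) ^^
        (inputValue α (carry C (4 ^ (l + 1) * k)) && α (.p C (l + 1) k))) =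
      (α (.g C l (4 * k + 3)) ^^
        (inputValue α (carry C (4 ^ l * (4 * k + 3))) && α (.p C l (4 * k + 3)))) := by
  simp only [claUnit] at h
  have h3 := (h.mono (Finset.subset_union_right.trans
    (Finset.subset_union_left.trans Finset.subset_union_left))).gateHolds
  have hc : inputValue α (carry C (4 ^ l * (4 * k + 3))) = α (.c C (4 ^ l * (4 * k + 3))) := by
    rw [carry, if_neg (by positivity)]; rfl
  have hg := (h.mono (Finset.subset_union_right.trans Finset.subset_union_left)).gateHolds
  have hp := (h.mono Finset.subset_union_right).gateHolds
  rw [hc, h3, hg, hp, show 4 ^ (l + 1) * k = 4 ^ l * (4 * k) by ring]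
  change ((α (.g C l (4 * k + 3)) ^^ (α (.g C l (4 * k + 2)) && α (.p C l (4 * k + 3))) ^^
      (α (.g C l (4 * k + 1)) && α (.p C l (4 * k + 2)) && α (.p C l (4 * k + 3))) ^^
      (α (.g C l (4 * k + 0)) && α (.p C l (4 * k + 1)) && α (.p C l (4 * k + 2)) &&
        α (.p C l (4 * k + 3)))) ^^ (inputValue α (carry C (4 ^ l * (4 * k))) &&
      (α (.p C l (4 * k + 0)) && α (.p C l (4 * k + 1)) && α (.p C l (4 * k + 2)) &&
        α (.p C l (4 * k + 3))))) = (α (.g C l (4 * k + 3)) ^^ ((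
      α (.g C l (4 * k + 2)) ^^ (α (.g C l (4 * k + 1)) && α (.p C l (4 * k + 2))) ^^
      (α (.g C l (4 * k + 0)) && α (.p C l (4 * k + 1)) && α (.p C l (4 * k + 2))) ^^
      (inputValue α (carry C (4 ^ l * (4 * k))) && α (.p C l (4 * k + 0)) &&
        α (.p C l (4 * k + 1)) && α (.p C l (4 * k + 2)))) && α (.p C l (4 * k + 3))))
  generalize inputValue α (carry C (4 ^ l * (4 * k))) = e
  cases α (.p C l (4 * k + 3))
  · simp
  · generalize α (.g C l (4 * k + 1)) = a, α (.g C l (4 * k + 0)) = b,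
      α (.p C l (4 * k + 1)) = c, α (.p C l (4 * k + 0)) = d,
      α (.g C l (4 * k + 2)) = a', α (.p C l (4 * k + 2)) = c', α (.g C l (4 * k + 3)) = a''
    revert a b c d e a' c' a''
    decide

/-- Descent through the levels: the carry out of a block is the carry out of its last subblock. All
units used contain position i, so a strip needs only the units above its own columns. -/
theorem carry_of_block {α : WVar → Bool} {C : Side} {m i : ℕ}
    (h : ∀ l < m, Models α (claUnit C l (i / 4 ^ (l + 1)))) (l b : ℕ) (hl : l ≤ m)
    (hb : i + 1 = 4 ^ l * (b + 1))
    (hc : α (.c C (i + 1)) = (α (.g C l b) ^^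
      (inputValue α (carry C (4 ^ l * b)) && α (.p C l b)))) :
    α (.c C (i + 1)) = (α (.g C 0 i) ^^ (inputValue α (carry C i) && α (.p C 0 i))) := by
  induction l generalizing b with
  | zero =>
    obtain rfl : i = b := by omega
    simpa using hc
  | succ l ih =>
    have hdiv : i / 4 ^ (l + 1) = b := by
      have hpos : 0 < 4 ^ (l + 1) := by positivity
      rw [Nat.div_eq_iff hpos]
      rw [mul_add] at hb
      constructor <;> rw [mul_comm b] <;> omega
    have hu := claUnit_group (h l (by omega))
    rw [hdiv] at hu
    exact ih (4 * b + 3) (by omega) (by rw [hb]; ring) (hc.trans hu)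

/-- The local rule for the carries, derived from the units that contain position `i`. -/
theorem carry_succ {α : WVar → Bool} {C : Side} {m i : ℕ}
    (h : ∀ l < m, Models α (claUnit C l (i / 4 ^ (l + 1)))) (hi : i + 1 < 4 ^ m) :
    α (.c C (i + 1)) = (α (.g C 0 i) ^^ (inputValue α (carry C i) && α (.p C 0 i))) := by
  -- The exponent v of 4 in i + 1 is the level whose unit issues this carry: 4 ∤ b + 1 says that the
  -- block ending at i is not the last one of its unit.
  obtain ⟨v, b, hb4, hb⟩ := Nat.exists_eq_pow_mul_and_not_dvd (Nat.succ_ne_zero i) 4 (by norm_num)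
  have hb0 : b ≠ 0 := by rintro rfl; simp at hb
  obtain ⟨b, rfl⟩ := Nat.exists_eq_succ_of_ne_zero hb0
  simp only [Nat.succ_eq_add_one] at hb hb4
  have hpos : 0 < 4 ^ v := by positivity
  have hv : v < m := by
    by_contra hv
    have := Nat.pow_le_pow_right (show 0 < 4 by norm_num) (not_lt.mp hv)
    have : 4 ^ v * 1 ≤ 4 ^ v * (b + 1) := Nat.mul_le_mul_left _ (by omega)
    omega
  refine carry_of_block h v b hv.le hb ?_
  have hdiv : i / 4 ^ (v + 1) = b / 4 := by
    rw [pow_succ, ← Nat.div_div_eq_div_mul]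
    congr 1
    rw [Nat.div_eq_iff hpos]
    rw [mul_add] at hb
    constructor <;> rw [mul_comm b] <;> omega
  have hu := claUnit_carry (h v hv) (s := b % 4) (by omega)
  rw [hdiv] at hu
  rw [show 4 * (b / 4) + b % 4 = b by omega, show 4 * (b / 4) + (b % 4 + 1) = b + 1 by omega,
    ← hb] at hu
  exact hu

end Wallace

namespace Wallace

/-! ## The strip of columns `lo, …, k` of a multiplier -/

/-- The assignment `α` satisfies the constraints of the strip `lo, …, k` of the multiplier `C`,
except for the partial products. -/
structure StripHolds (n : ℕ) (C : Side) (lo k : ℕ) (α : WVar → Bool) : Prop where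
  sum : ∀ l < lastLayer n, ∀ i, lo ≤ i → i ≤ k → ∀ j < numSums (height n l i),
    GateHolds α (.t C (l + 1) i (sumPos n l i j)) (adderInputs n C l i j) xor3
  carry : ∀ l < lastLayer n, ∀ i, lo ≤ i → i + 1 ≤ k → ∀ j < numCarries (height n l i),
    GateHolds α (.t C (l + 1) (i + 1) (carryPos n l i j)) (adderInputs n C l i j) maj3
  generate : ∀ i, lo ≤ i → i < k → GateHolds α (.g C 0 i)
    ![cell n C (lastLayer n) i 0, cell n C (lastLayer n) i 1] and2
  propagate : ∀ i, lo ≤ i → i < k → GateHolds α (.p C 0 i)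
    ![cell n C (lastLayer n) i 0, cell n C (lastLayer n) i 1] xor2
  unit : ∀ i, lo ≤ i → i < k → ∀ l < claLevels n, Models α (claUnit C l (i / 4 ^ (l + 1)))
  out : ∀ i, lo ≤ i → i ≤ k → GateHolds α (.o C i)
    ![Wallace.carry C i, cell n C (lastLayer n) i 0, cell n C (lastLayer n) i 1] xor3

/-- The sum of the bits of column `i` of layer `l`. -/
def columnSum (n : ℕ) (C : Side) (α : WVar → Bool) (l i : ℕ) : ℕ :=
  ∑ r ∈ Finset.range (height n l i), (α (.t C l i r)).toNat

variable {n lo w : ℕ} {C : Side} {α : WVar → Bool}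

theorem sum_toNat_le (N : ℕ) (f : ℕ → Bool) : ∑ j ∈ Finset.range N, (f j).toNat ≤ N :=
  (Finset.sum_le_sum fun _ _ => Bool.toNat_le _).trans (by simp)

/-- The carries q from column lo - 1 are unconstrained within the strip, and only their number
matters; carries out of the top column have weight 2^(w+1) and vanish. -/
theorem StripHolds.layer (h : StripHolds n C lo (lo + w) α) (hn : 2 ≤ n) (hk : lo + w < 2 * n)
    {l : ℕ} (hl : l < lastLayer n) : ∃ q ≤ n, (lo = 0 → q = 0) ∧
      ∑ d ∈ Finset.range (w + 1), 2 ^ d * columnSum n C α l (lo + d) + q ≡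
        ∑ d ∈ Finset.range (w + 1), 2 ^ d * columnSum n C α (l + 1) (lo + d) [MOD 2 ^ (w + 1)] := by
  let Cr : ℕ → ℕ := fun i => ∑ j ∈ Finset.range (numCarries (height n l i)),
    (maj3 fun s => inputValue α (adderInputs n C l i j s)).toNat
  let Sm : ℕ → ℕ := fun i => ∑ j ∈ Finset.range (numSums (height n l i)),
    (xor3 fun s => inputValue α (adderInputs n C l i j s)).toNat
  have hSm : ∀ i, lo ≤ i → i ≤ lo + w → ∑ j ∈ Finset.range (numSums (height n l i)),
      (α (.t C (l + 1) i (sumPos n l i j))).toNat = Sm i := fun i h1 h2 =>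
    Finset.sum_congr rfl fun j hj => by rw [h.sum l hl i h1 h2 j (Finset.mem_range.mp hj)]
  have hCr : ∀ i, lo ≤ i → i + 1 ≤ lo + w → ∑ j ∈ Finset.range (numCarries (height n l i)),
      (α (.t C (l + 1) (i + 1) (carryPos n l i j))).toNat = Cr i := fun i h1 h2 =>
    Finset.sum_congr rfl fun j hj => by rw [h.carry l hl i h1 h2 j (Finset.mem_range.mp hj)]
  obtain ⟨q, hqn, hq0, hq⟩ : ∃ q ≤ n, (lo = 0 → q = 0) ∧
      columnSum n C α (l + 1) lo = Sm lo + q := by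
    rcases Nat.eq_zero_or_pos lo with rfl | hlo
    · refine ⟨0, by omega, fun _ => rfl, ?_⟩
      rw [columnSum, sum_layer_succ_zero (by omega), hSm 0 le_rfl (by omega), add_zero]
    · obtain ⟨i, rfl⟩ : ∃ i, lo = i + 1 := ⟨lo - 1, by omega⟩
      refine ⟨_, (sum_toNat_le (numCarries (height n l i))
        fun j => α (.t C (l + 1) (i + 1) (carryPos n l i j))).trans ?_, by omega, ?_⟩
      · have := height_le n l i hn
        simp only [numCarries]; omega
      · rw [columnSum, sum_layer_succ (by omega), hSm _ le_rfl (by omega)]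
  refine ⟨q, hqn, hq0, ?_⟩
  let c : ℕ → ℕ := fun d => if d = 0 then q else Cr (lo + (d - 1))
  refine sum_add_carry_modEq (fun d => columnSum n C α l (lo + d))
    (fun d => columnSum n C α (l + 1) (lo + d)) c (w + 1) fun d hd => ?_
  have h1 : columnSum n C α l (lo + d) = Sm (lo + d) + 2 * Cr (lo + d) := sum_column n C l _ α
  have h2 : columnSum n C α (l + 1) (lo + d) = Sm (lo + d) + c d := by
    cases d with
    | zero => exact hq
    | succ d =>
      rw [columnSum, ← add_assoc, sum_layer_succ (by omega), hSm _ (by omega) (by omega),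
        hCr _ (by omega) (by omega)]
      rfl
  have h3 : c (d + 1) = Cr (lo + d) := rfl
  rw [h1, h2, h3]
  ring

theorem StripHolds.layers (h : StripHolds n C lo (lo + w) α) (hn : 2 ≤ n) (hk : lo + w < 2 * n)
    (l : ℕ) (hl : l ≤ lastLayer n) : ∃ q ≤ n * l, (lo = 0 → q = 0) ∧
      ∑ d ∈ Finset.range (w + 1), 2 ^ d * columnSum n C α 0 (lo + d) + q ≡
        ∑ d ∈ Finset.range (w + 1), 2 ^ d * columnSum n C α l (lo + d) [MOD 2 ^ (w + 1)] := by
  induction l with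
  | zero => exact ⟨0, by simp, fun _ => rfl, Nat.ModEq.refl _⟩
  | succ l ih =>
    obtain ⟨q, hq, hq0, hmod⟩ := ih (by omega)
    obtain ⟨q', hq', hq0', hmod'⟩ := h.layer hn hk (show l < lastLayer n by omega)
    refine ⟨q + q', by rw [mul_add]; omega, fun h0 => by rw [hq0 h0, hq0' h0], ?_⟩
    rw [← add_assoc]
    exact (hmod.add_right q').trans hmod'

theorem columnSum_lastLayer {i : ℕ} (hi : i < 2 * n) : columnSum n C α (lastLayer n) i =
    (inputValue α (cell n C (lastLayer n) i 0)).toNat +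
      (inputValue α (cell n C (lastLayer n) i 1)).toNat := by
  have h2 := height_lastLayer hi
  simp only [columnSum, cell]
  generalize height n (lastLayer n) i = H at *
  obtain rfl | rfl | rfl : H = 0 ∨ H = 1 ∨ H = 2 := by omega
  all_goals simp [Finset.sum_range_succ, inputValue]

theorem two_mul_le_pow_claLevels (n : ℕ) : 2 * n ≤ 4 ^ claLevels n :=
  Nat.le_pow_clog (by norm_num) _

theorem StripHolds.adder (h : StripHolds n C lo (lo + w) α) (hk : lo + w < 2 * n) :
    ∑ d ∈ Finset.range (w + 1), 2 ^ d * columnSum n C α (lastLayer n) (lo + d) +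
        (inputValue α (Wallace.carry C lo)).toNat ≡
      ∑ d ∈ Finset.range (w + 1), 2 ^ d * (α (.o C (lo + d))).toNat [MOD 2 ^ (w + 1)] := by
  let a : ℕ → Bool := fun i => inputValue α (cell n C (lastLayer n) i 0)
  let b : ℕ → Bool := fun i => inputValue α (cell n C (lastLayer n) i 1)
  let cin : ℕ → Bool := fun i => inputValue α (Wallace.carry C i)
  -- The strip contains no rule for the carry out of its top column. The majority is a stand-in that
  -- satisfies the column equation, and the modulus discards it.
  let c : ℕ → ℕ := fun d => if d = w + 1 then
    ((a (lo + w) && b (lo + w)) || (a (lo + w) && cin (lo + w)) ||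
      (b (lo + w) && cin (lo + w))).toNat else (cin (lo + d)).toNat
  refine sum_add_carry_modEq (fun d => columnSum n C α (lastLayer n) (lo + d))
    (fun d => (α (.o C (lo + d))).toNat) c (w + 1) fun d hd => ?_
  have h1 : columnSum n C α (lastLayer n) (lo + d) = (a (lo + d)).toNat + (b (lo + d)).toNat :=
    columnSum_lastLayer (by omega)
  have h2 : α (.o C (lo + d)) = (cin (lo + d) ^^ a (lo + d) ^^ b (lo + d)) :=
    h.out (lo + d) (by omega) (by omega)
  have h3 : c d = (cin (lo + d)).toNat := by simp [c, show d ≠ w + 1 by omega]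
  have h4 : c (d + 1) = ((a (lo + d) && b (lo + d)) || (a (lo + d) && cin (lo + d)) ||
      (b (lo + d) && cin (lo + d))).toNat := by
    by_cases hdw : d = w
    · subst hdw; simp [c]
    · have hg : α (.g C 0 (lo + d)) = (a (lo + d) && b (lo + d)) :=
        h.generate (lo + d) (by omega) (by omega)
      have hp : α (.p C 0 (lo + d)) = (a (lo + d) ^^ b (lo + d)) :=
        h.propagate (lo + d) (by omega) (by omega)
      have hc := carry_succ (h.unit (lo + d) (by omega) (by omega))
        (by have := two_mul_le_pow_claLevels n; omega)
      have : c (d + 1) = (α (.c C (lo + d + 1))).toNat := by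
        simp [c, hdw, cin, ← add_assoc, Wallace.carry, inputValue]
      rw [this, hc, hg, hp]
      change ((a (lo + d) && b (lo + d)) ^^ (cin (lo + d) && (a (lo + d) ^^ b (lo + d)))).toNat = _
      generalize a (lo + d) = x, b (lo + d) = y, cin (lo + d) = z
      revert x y z
      decide
  rw [h1, h2, h3, h4]
  generalize a (lo + d) = x, b (lo + d) = y, cin (lo + d) = z
  revert x y z
  decide

theorem StripHolds.sum_outputs (h : StripHolds n C lo (lo + w) α) (hn : 2 ≤ n)
    (hk : lo + w < 2 * n) : ∃ q ≤ n * lastLayer n + 1, (lo = 0 → q = 0) ∧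
      ∑ d ∈ Finset.range (w + 1), 2 ^ d * columnSum n C α 0 (lo + d) + q ≡
        ∑ d ∈ Finset.range (w + 1), 2 ^ d * (α (.o C (lo + d))).toNat [MOD 2 ^ (w + 1)] := by
  obtain ⟨q, hq, hq0, hmod⟩ := h.layers hn hk (lastLayer n) le_rfl
  refine ⟨q + (inputValue α (Wallace.carry C lo)).toNat, ?_, ?_, ?_⟩
  · have := Bool.toNat_le (inputValue α (Wallace.carry C lo))
    omega
  · rintro rfl
    rw [hq0 rfl]
    rfl
  · rw [← add_assoc]
    exact (hmod.add_right _).trans (h.adder hk)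

/-- The partial products of column `i` of the two multipliers agree up to the order. -/
theorem columnSum_zero_comm {i : ℕ} (hi : i < 2 * n)
    (hL : ∀ r < height n 0 i, GateHolds α (.t .L 0 i r)
      ![some (.x (i - (i - (n - 1) + r))), some (.y (i - (n - 1) + r))] and2)
    (hR : ∀ r < height n 0 i, GateHolds α (.t .R 0 i r)
      ![some (.y (i - (i - (n - 1) + r))), some (.x (i - (n - 1) + r))] and2) :
    columnSum n .L α 0 i = columnSum n .R α 0 i := by
  -- The alternative covers an empty column, such as 2n-1, where the left side is 1 because of
  -- truncated subtraction.
  have hH : i - 2 * (i - (n - 1)) + 1 = height n 0 i ∨ height n 0 i = 0 := by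
    simp only [height]; split <;> omega
  simp only [columnSum]
  rw [← Finset.sum_range_reflect]
  refine Finset.sum_congr rfl fun r hr => ?_
  have hr := Finset.mem_range.mp hr
  rw [hL _ (by omega), hR r hr]
  change (α (.x (i - (i - (n - 1) + (height n 0 i - 1 - r)))) &&
    α (.y (i - (n - 1) + (height n 0 i - 1 - r)))).toNat =
    (α (.y (i - (i - (n - 1) + r))) && α (.x (i - (n - 1) + r))).toNat
  have hlt : r + (i - (n - 1)) + (i - (n - 1)) ≤ i := by
    simp only [height] at hr
    split at hr <;> omega
  rw [Bool.and_comm, show i - (n - 1) + (height n 0 i - 1 - r) = i - (i - (n - 1) + r) by omega,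
    show i - (i - (i - (n - 1) + r)) = i - (n - 1) + r by omega]

end Wallace

namespace Wallace

/-! ## Gates of the instance -/

/-- The first factor of the multiplier `C`. -/
def factorU : Side → ℕ → WVar
  | .L => .x
  | .R => .y

/-- The second factor of the multiplier `C`. -/
def factorV : Side → ℕ → WVar
  | .L => .y
  | .R => .x

theorem multiplier_subset (n : ℕ) (C : Side) :
    multiplier n C (factorU C) (factorV C) ⊆ commInstance n := by
  cases C
  · exact Finset.subset_union_left.trans Finset.subset_union_left
  · exact Finset.subset_union_right.trans Finset.subset_union_left

theorem partialProduct_gate_subset {n i r : ℕ} (C : Side) (hi : i < 2 * n)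
    (hr : r < height n 0 i) :
    gate (.t C 0 i r) ![some (factorU C (i - (i - (n - 1) + r))),
      some (factorV C (i - (n - 1) + r))] and2 ⊆ commInstance n := by
  refine subset_trans ?_ (multiplier_subset n C)
  refine subset_trans ?_ (Finset.subset_union_left.trans Finset.subset_union_left)
  intro D hD
  simp only [partialProducts, Finset.mem_biUnion, Finset.mem_range]
  exact ⟨i, hi, r, hr, hD⟩

theorem sum_gate_subset {n l i j : ℕ} (C : Side) (hl : l < lastLayer n) (hi : i < 2 * n)
    (hj : j < numSums (height n l i)) :
    gate (.t C (l + 1) i (sumPos n l i j)) (adderInputs n C l i j) xor3 ⊆ commInstance n := by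
  refine subset_trans ?_ (multiplier_subset n C)
  refine subset_trans ?_ (Finset.subset_union_right.trans Finset.subset_union_left)
  intro D hD
  simp only [adders, Finset.mem_biUnion, Finset.mem_range]
  exact ⟨l, hl, i, hi, Finset.mem_union_left _ (Finset.mem_biUnion.mpr
    ⟨j, Finset.mem_range.mpr hj, hD⟩)⟩

theorem carry_gate_subset {n l i j : ℕ} (C : Side) (hl : l < lastLayer n) (hi : i + 1 < 2 * n)
    (hj : j < numCarries (height n l i)) :
    gate (.t C (l + 1) (i + 1) (carryPos n l i j)) (adderInputs n C l i j) maj3 ⊆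
      commInstance n := by
  refine subset_trans ?_ (multiplier_subset n C)
  refine subset_trans ?_ (Finset.subset_union_right.trans Finset.subset_union_left)
  intro D hD
  simp only [adders, Finset.mem_biUnion, Finset.mem_range]
  refine ⟨l, hl, i, by omega, Finset.mem_union_right _ ?_⟩
  rw [if_pos hi]
  exact Finset.mem_biUnion.mpr ⟨j, Finset.mem_range.mpr hj, hD⟩

theorem base_gates_subset {n i : ℕ} (C : Side) (hi : i < 2 * n) :
    gate (.g C 0 i) ![cell n C (lastLayer n) i 0, cell n C (lastLayer n) i 1] and2 ∪
      gate (.p C 0 i) ![cell n C (lastLayer n) i 0, cell n C (lastLayer n) i 1] xor2 ⊆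
      commInstance n := by
  refine subset_trans ?_ (multiplier_subset n C)
  refine subset_trans ?_ Finset.subset_union_right
  refine subset_trans ?_ (Finset.subset_union_left.trans Finset.subset_union_left)
  intro D hD
  have := two_mul_le_pow_claLevels n
  exact Finset.mem_biUnion.mpr ⟨i, Finset.mem_range.mpr (by omega), hD⟩

theorem claUnit_subset {n i l : ℕ} (C : Side) (hi : i < 2 * n) (hl : l < claLevels n) :
    claUnit C l (i / 4 ^ (l + 1)) ⊆ commInstance n := by
  refine subset_trans ?_ (multiplier_subset n C)
  refine subset_trans ?_ Finset.subset_union_right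
  refine subset_trans ?_ (Finset.subset_union_right.trans Finset.subset_union_left)
  intro D hD
  have h1 := two_mul_le_pow_claLevels n
  refine Finset.mem_biUnion.mpr ⟨l, Finset.mem_range.mpr hl, Finset.mem_biUnion.mpr
    ⟨_, Finset.mem_range.mpr ?_, hD⟩⟩
  rw [Nat.div_lt_iff_lt_mul (by positivity), ← pow_add, Nat.sub_add_cancel (by omega)]
  omega

theorem output_gate_subset {n i : ℕ} (C : Side) (hi : i < 2 * n) :
    gate (.o C i) ![carry C i, cell n C (lastLayer n) i 0, cell n C (lastLayer n) i 1] xor3 ⊆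
      commInstance n := by
  refine subset_trans ?_ (multiplier_subset n C)
  refine subset_trans ?_ Finset.subset_union_right
  refine subset_trans ?_ Finset.subset_union_right
  intro D hD
  exact Finset.mem_biUnion.mpr ⟨i, Finset.mem_range.mpr hi, hD⟩

theorem comparison_gate_subset {n i : ℕ} (hi : i < 2 * n) :
    gate (.e i) ![some (.o .L i), some (.o .R i)] (fun a => (!a 0 && a 1) || (a 0 && !a 1)) ⊆
      commInstance n := by
  refine subset_trans ?_ Finset.subset_union_right
  refine subset_trans ?_ Finset.subset_union_left
  intro D hD
  exact Finset.mem_biUnion.mpr ⟨i, Finset.mem_range.mpr hi, hD⟩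

theorem inequality_clause_mem (n : ℕ) :
    ((Finset.range (2 * n)).image fun i => (WVar.e i, true)) ∈ commInstance n :=
  Finset.mem_union_right _ (Finset.mem_union_right _ (Finset.mem_singleton_self _))

/-! ## The variables of a strip and their schedule -/

/-- The tableau variables of the strip outside of the last layer, and the input bits. -/
def stripDynamic (n lo k : ℕ) : Finset WVar :=
  (Finset.range n).image .x ∪ (Finset.range n).image .y ∪
    ({Side.L, Side.R} : Finset Side).biUnion fun C => (Finset.range (lastLayer n)).biUnion fun l =>
      (Finset.Icc lo k).biUnion fun i => (Finset.range n).image (.t C l i)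

/-- The comparison bits of the strip. -/
def stripComparison (lo k : ℕ) : Finset WVar := (Finset.Icc lo k).image .e

/-- The variables of the `l`-th level of the carry-lookahead adder in the unit above position `i`. -/
def unitVars (C : Side) (i l : ℕ) : Finset WVar :=
  {.g C (l + 1) (i / 4 ^ (l + 1)), .p C (l + 1) (i / 4 ^ (l + 1))} ∪
    (Finset.range 4).biUnion fun s => {.g C l (4 * (i / 4 ^ (l + 1)) + s),
      .p C l (4 * (i / 4 ^ (l + 1)) + s), .c C (4 ^ l * (4 * (i / 4 ^ (l + 1)) + s))}

/-- The variables of the strip in the last layer, in the carry-lookahead adder and behind it. -/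
def stripStatic (n lo k : ℕ) : Finset WVar :=
  stripComparison lo k ∪
    ({Side.L, Side.R} : Finset Side).biUnion fun C => (Finset.Icc lo k).biUnion fun i =>
      {.o C i, .c C i, .t C (lastLayer n) i 0, .t C (lastLayer n) i 1, .g C 0 i, .p C 0 i} ∪
        (Finset.range (claLevels n)).biUnion fun l => unitVars C i l

/-- The multiplier `R` is traversed in the direction opposite to `L`. -/
def sideTime (n k : ℕ) : Side → ℕ → ℤ
  | .L, b => b
  | .R, b => (min k (n - 1) : ℕ) - (k - (n - 1) : ℕ) - b

/-- The first time at which a variable is in use. -/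
def firstUse (n lo k : ℕ) : WVar → ℤ
  | .x m => (min k (n - 1) : ℕ) - m - (k - lo : ℕ)
  | .y m => m - (k - (n - 1) : ℕ)
  | .t .L l _ r => sideTime n k .L (birth l r)
  | .t .R l _ r => sideTime n k .R (birth l (r + 2))
  | _ => 0

/-- The last time at which a variable is in use. -/
def lastUse (n lo k : ℕ) : WVar → ℤ
  | .x m => (min k (n - 1) : ℕ) - m
  | .y m => m - (k - (n - 1) : ℕ) + (k - lo : ℕ)
  | .t .L l _ r => sideTime n k .L (birth l (r + 2))
  | .t .R l _ r => sideTime n k .R (birth l r)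
  | _ => 0

/-- The clauses of the strip that respect the schedule. -/
def stripClauses (n lo k : ℕ) : Finset (Clause WVar) :=
  (commInstance n).filter fun D =>
    Clause.vars D ⊆ stripDynamic n lo k ∪ stripStatic n lo k ∧
    (∃ v ∈ Clause.vars D, v ∉ stripComparison lo k) ∧
    ∀ u ∈ Clause.vars D, ∀ v ∈ Clause.vars D, u ∉ stripStatic n lo k → v ∉ stripStatic n lo k →
      firstUse n lo k u ≤ lastUse n lo k v

/-- The variable `v` can be used at time `t` of the schedule. -/
def Available (n lo k : ℕ) (t : ℤ) (v : WVar) : Prop :=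
  v ∈ stripStatic n lo k ∨
    v ∈ stripDynamic n lo k ∧ firstUse n lo k v ≤ t ∧ t ≤ lastUse n lo k v

/-- One common time t at which all variables of the gate are available makes their intervals meet
pairwise. The last hypothesis ensures that elimination touches each clause of the gate. -/
theorem gate_subset_stripClauses {n lo k : ℕ} {z : WVar} {m : ℕ} {ins : Fin m → Option WVar}
    {f : (Fin m → Bool) → Bool} (h : gate z ins f ⊆ commInstance n) (t : ℤ)
    (hz : Available n lo k t z) (hins : ∀ s v, ins s = some v → Available n lo k t v)
    (hE : z ∉ stripComparison lo k ∨ ∃ s v, ins s = some v ∧ v ∉ stripComparison lo k) :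
    gate z ins f ⊆ stripClauses n lo k := by
  intro D hD
  have hav : ∀ u ∈ Clause.vars D, Available n lo k t u := by
    intro u hu
    rcases mem_vars_of_mem_gate hD hu with rfl | ⟨s, hs⟩
    · exact hz
    · exact hins s u hs
  refine Finset.mem_filter.mpr ⟨h hD, fun u hu => ?_, ?_, fun u hu v hv hu' hv' => ?_⟩
  · rcases hav u hu with h | h
    · exact Finset.mem_union_right _ h
    · exact Finset.mem_union_left _ h.1
  · rcases hE with hE | ⟨s, v, hs, hv⟩
    · exact ⟨z, output_mem_vars_of_mem_gate hD, hE⟩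
    · exact ⟨v, input_mem_vars_of_mem_gate hD hs, hv⟩
  · exact ((hav u hu).resolve_left hu').2.1.trans ((hav v hv).resolve_left hv').2.2

theorem mem_stripComparison {lo k : ℕ} {v : WVar} :
    v ∈ stripComparison lo k ↔ ∃ i, (lo ≤ i ∧ i ≤ k) ∧ .e i = v := by
  simp [stripComparison]

theorem mem_stripStatic {n lo k : ℕ} {v : WVar} : v ∈ stripStatic n lo k ↔
    v ∈ stripComparison lo k ∨ ∃ C i, (lo ≤ i ∧ i ≤ k) ∧
      (v ∈ ({.o C i, .c C i, .t C (lastLayer n) i 0, .t C (lastLayer n) i 1, .g C 0 i, .p C 0 i} :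
        Finset WVar) ∨ ∃ l < claLevels n, v ∈ unitVars C i l) := by
  have hC : ∀ C : Side, C ∈ ({Side.L, Side.R} : Finset Side) := by rintro (_ | _) <;> simp
  simp only [stripStatic, Finset.mem_union, Finset.mem_biUnion, Finset.mem_Icc, Finset.mem_range,
    hC, true_and]

theorem mem_stripStatic_of_local {n lo k : ℕ} {v : WVar} (C : Side) {i : ℕ} (h1 : lo ≤ i)
    (h2 : i ≤ k) (h : v ∈ ({.o C i, .c C i, .t C (lastLayer n) i 0, .t C (lastLayer n) i 1,
      .g C 0 i, .p C 0 i} : Finset WVar)) : v ∈ stripStatic n lo k :=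
  mem_stripStatic.mpr (Or.inr ⟨C, i, ⟨h1, h2⟩, Or.inl h⟩)

theorem cell_available {n lo k l i r b : ℕ} (hn : 2 ≤ n) (hk : k < 2 * n) (C : Side)
    (h1 : lo ≤ i) (h2 : i ≤ k) (hl : l ≤ lastLayer n) (hr : r < height n l i)
    (hb1 : birth l r ≤ b) (hb2 : b ≤ birth l (r + 2)) :
    Available n lo k (sideTime n k C b) (.t C l i r) := by
  rcases hl.eq_or_lt with rfl | hl
  · left
    have := height_lastLayer (show i < 2 * n by omega)
    refine mem_stripStatic_of_local C h1 h2 ?_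
    obtain rfl | rfl : r = 0 ∨ r = 1 := by omega
    · simp
    · simp
  · right
    have hrn := height_le n l i hn
    constructor
    · have hC : C ∈ ({Side.L, Side.R} : Finset Side) := by cases C <;> simp
      refine Finset.mem_union_right _ (Finset.mem_biUnion.mpr ⟨C, hC, Finset.mem_biUnion.mpr
        ⟨l, Finset.mem_range.mpr hl, Finset.mem_biUnion.mpr ⟨i, Finset.mem_Icc.mpr ⟨h1, h2⟩,
          Finset.mem_image_of_mem _ (Finset.mem_range.mpr (by omega))⟩⟩⟩)
    · cases C <;> simp only [firstUse, lastUse, sideTime] <;> omega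

theorem not_mem_stripComparison {lo k : ℕ} {v : WVar} (h : ∀ i, v ≠ .e i) :
    v ∉ stripComparison lo k := by
  rw [mem_stripComparison]
  rintro ⟨i, -, rfl⟩
  exact h i rfl

theorem cell_eq_some {n l i r : ℕ} {C : Side} {v : WVar} (h : cell n C l i r = some v) :
    r < height n l i ∧ v = .t C l i r := by
  unfold cell at h
  split at h
  · exact ⟨by assumption, (Option.some_injective _ h).symm⟩
  · cases h

/-- The j-th adder acts at time `birth l (3 * j + 2)`, when its last input is born. Its inputs r
satisfy r ≤ 3j + 2 ≤ r + 2, so all are then live. -/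
theorem adderInputs_available {n lo k l i j : ℕ} (hn : 2 ≤ n) (hk : k < 2 * n) (C : Side)
    (h1 : lo ≤ i) (h2 : i ≤ k) (hl : l < lastLayer n) (s : Fin 3) (v : WVar)
    (hs : adderInputs n C l i j s = some v) :
    Available n lo k (sideTime n k C (birth l (3 * j + 2))) v := by
  fin_cases s
  all_goals
    obtain ⟨hr, rfl⟩ := cell_eq_some hs
    exact cell_available hn hk C h1 h2 hl.le hr (birth_mono l (by omega)) (birth_mono l (by omega))

theorem stripHolds {n lo k : ℕ} (hn : 2 ≤ n) (hk : k < 2 * n) (C : Side) {α : WVar → Bool}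
    (h : Models α (stripClauses n lo k)) : StripHolds n C lo k α where
  sum l hl i h1 h2 j hj := by
    have hi : i < 2 * n := by omega
    refine (h.mono (gate_subset_stripClauses (sum_gate_subset C hl hi hj)
      (sideTime n k C (birth l (3 * j + 2))) ?_ (adderInputs_available hn hk C h1 h2 hl)
      (Or.inl (not_mem_stripComparison (by simp))))).gateHolds
    -- The output is born exactly when its adder acts.
    have hpos : birth (l + 1) (sumPos n l i j) = birth l (3 * j + 2) := by
      rw [birth, sumPos_eq hi hj, Nat.mul_div_cancel_left _ (by norm_num)]
    refine cell_available hn hk C h1 h2 hl ?_ hpos.le (hpos ▸ birth_mono _ (by omega))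
    rw [height_succ l hi, sumPos]
    omega
  carry l hl i h1 h2 j hj := by
    have hi : i + 1 < 2 * n := by omega
    refine (h.mono (gate_subset_stripClauses (carry_gate_subset C hl hi hj)
      (sideTime n k C (birth l (3 * j + 2))) ?_ (adderInputs_available hn hk C h1 (by omega) hl)
      (Or.inl (not_mem_stripComparison (by simp))))).gateHolds
    have hpos : birth (l + 1) (carryPos n l i j) = birth l (3 * j + 2) := by
      rw [birth, carryPos_div_two hi hj]
    refine cell_available hn hk C (by omega) h2 hl ?_ hpos.le (hpos ▸ birth_mono _ (by omega))
    rw [height_succ l hi, carryPos, carriesInto]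
    omega
  generate i h1 h2 := by
    refine (h.mono (gate_subset_stripClauses
      (Finset.subset_union_left.trans (base_gates_subset C (by omega))) 0 (Or.inl ?_) ?_
      (Or.inl (not_mem_stripComparison (by simp))))).gateHolds
    · exact mem_stripStatic_of_local C h1 h2.le (by simp)
    · intro s v hs
      left
      fin_cases s <;> obtain ⟨-, rfl⟩ := cell_eq_some hs <;>
        exact mem_stripStatic_of_local C h1 h2.le (by simp)
  propagate i h1 h2 := by
    refine (h.mono (gate_subset_stripClauses
      (Finset.subset_union_right.trans (base_gates_subset C (by omega))) 0 (Or.inl ?_) ?_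
      (Or.inl (not_mem_stripComparison (by simp))))).gateHolds
    · exact mem_stripStatic_of_local C h1 h2.le (by simp)
    · intro s v hs
      left
      fin_cases s <;> obtain ⟨-, rfl⟩ := cell_eq_some hs <;>
        exact mem_stripStatic_of_local C h1 h2.le (by simp)
  unit i h1 h2 l hl := by
    refine h.mono ?_
    have hcla := claUnit_subset C (show i < 2 * n by omega) hl
    have hmem : ∀ v ∈ unitVars C i l, Available n lo k 0 v := fun v hv =>
      Or.inl (mem_stripStatic.mpr (Or.inr ⟨C, i, ⟨h1, h2.le⟩, Or.inr ⟨l, hl, hv⟩⟩))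
    simp only [claUnit, Finset.union_subset_iff] at hcla ⊢
    have hsub : ∀ s < 4, ∀ v ∈ ({.g C l (4 * (i / 4 ^ (l + 1)) + s),
        .p C l (4 * (i / 4 ^ (l + 1)) + s), .c C (4 ^ l * (4 * (i / 4 ^ (l + 1)) + s))} :
          Finset WVar), Available n lo k 0 v := fun s hs v hv =>
      hmem v (Finset.mem_union_right _ (Finset.mem_biUnion.mpr ⟨s, Finset.mem_range.mpr hs, hv⟩))
    have hg : ∀ s < 4, ∀ v, some (WVar.g C l (4 * (i / 4 ^ (l + 1)) + s)) = some v →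
        Available n lo k 0 v := fun s hs v hv =>
      hsub s hs v (by rw [← Option.some_injective _ hv]; simp)
    have hp : ∀ s < 4, ∀ v, some (WVar.p C l (4 * (i / 4 ^ (l + 1)) + s)) = some v →
        Available n lo k 0 v := fun s hs v hv =>
      hsub s hs v (by rw [← Option.some_injective _ hv]; simp)
    have hc : ∀ v, Wallace.carry C (4 ^ l * (4 * (i / 4 ^ (l + 1)))) = some v →
        Available n lo k 0 v := by
      intro v hv
      unfold Wallace.carry at hv
      split at hv
      · cases hv
      · exact hsub 0 (by norm_num) v (by rw [← Option.some_injective _ hv]; simp)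
    have lift : ∀ {z : WVar} {m : ℕ} {ins : Fin m → Option WVar} {f : (Fin m → Bool) → Bool},
        gate z ins f ⊆ commInstance n → (∀ i, z ≠ .e i) → Available n lo k 0 z →
        (∀ s v, ins s = some v → Available n lo k 0 v) → gate z ins f ⊆ stripClauses n lo k :=
      fun h hz hza hins => gate_subset_stripClauses h 0 hza hins
        (Or.inl (not_mem_stripComparison hz))
    refine ⟨⟨⟨⟨lift hcla.1.1.1.1 (by simp) (hsub 1 (by norm_num) _ (by simp)) ?_,
      lift hcla.1.1.1.2 (by simp) (hsub 2 (by norm_num) _ (by simp)) ?_⟩,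
      lift hcla.1.1.2 (by simp) (hsub 3 (by norm_num) _ (by simp)) ?_⟩,
      lift hcla.1.2 (by simp) (hmem _ (by simp [unitVars])) ?_⟩,
      lift hcla.2 (by simp) (hmem _ (by simp [unitVars])) ?_⟩
    all_goals
      intro s v hs
      fin_cases s
      all_goals first
        | exact hc v hs
        | exact hg 0 (by norm_num) v hs
        | exact hg 1 (by norm_num) v hs
        | exact hg 2 (by norm_num) v hs
        | exact hg 3 (by norm_num) v hs
        | exact hp 0 (by norm_num) v hs
        | exact hp 1 (by norm_num) v hs
        | exact hp 2 (by norm_num) v hs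
        | exact hp 3 (by norm_num) v hs
  out i h1 h2 := by
    refine (h.mono (gate_subset_stripClauses (output_gate_subset C (by omega)) 0 (Or.inl ?_) ?_
      (Or.inl (not_mem_stripComparison (by simp))))).gateHolds
    · exact mem_stripStatic_of_local C h1 h2 (by simp)
    · intro s v hs
      left
      fin_cases s
      · change Wallace.carry C i = some v at hs
        unfold Wallace.carry at hs
        split at hs
        · cases hs
        · exact mem_stripStatic_of_local C h1 h2
            (by rw [← Option.some_injective _ hs]; simp)
      all_goals
        obtain ⟨-, rfl⟩ := cell_eq_some hs
        exact mem_stripStatic_of_local C h1 h2 (by simp)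

/-- Down column i of L the index of y rises from i - (n-1) and that of x falls from min(i, n-1); in
R the roles are exchanged, and reversed time restores them. Moving through the strip shifts each
index by at most k - lo, the length of the intervals of the input bits. -/
theorem partialProduct_holds {n lo k i r : ℕ} (hn : 2 ≤ n) (hk : k < 2 * n) (C : Side)
    {α : WVar → Bool} (h : Models α (stripClauses n lo k)) (h1 : lo ≤ i) (h2 : i ≤ k)
    (hr : r < height n 0 i) : GateHolds α (.t C 0 i r) ![some (factorU C (i - (i - (n - 1) + r))),
      some (factorV C (i - (n - 1) + r))] and2 := by
  refine (h.mono (gate_subset_stripClauses (partialProduct_gate_subset C (by omega) hr)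
    (sideTime n k C (birth 0 r)) (cell_available hn hk C h1 h2 (Nat.zero_le _) hr le_rfl
      (birth_mono 0 (by omega))) ?_ (Or.inl (not_mem_stripComparison (by simp))))).gateHolds
  have hlt : r + (i - (n - 1)) + (i - (n - 1)) ≤ i ∧ i - (n - 1) + r < n := by
    simp only [height] at hr
    split at hr <;> omega
  have hx : ∀ m, m < n → WVar.x m ∈ stripDynamic n lo k := fun m hm => by
    simp [stripDynamic, hm]
  have hy : ∀ m, m < n → WVar.y m ∈ stripDynamic n lo k := fun m hm => by
    simp [stripDynamic, hm]
  intro s v hs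
  right
  fin_cases s <;> cases C <;> obtain rfl := Option.some_injective _ hs
  · refine ⟨hx _ (by omega), ?_⟩
    simp only [firstUse, lastUse, sideTime, birth, factorU]
    omega
  · refine ⟨hy _ (by omega), ?_⟩
    simp only [firstUse, lastUse, sideTime, birth, factorU]
    omega
  · refine ⟨hy _ (by omega), ?_⟩
    simp only [firstUse, lastUse, sideTime, birth, factorV]
    omega
  · refine ⟨hx _ (by omega), ?_⟩
    simp only [firstUse, lastUse, sideTime, birth, factorV]
    omega

theorem comparison_holds {n lo k i : ℕ} (hk : k < 2 * n)
    {α : WVar → Bool} (h : Models α (stripClauses n lo k)) (h1 : lo ≤ i) (h2 : i ≤ k) :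
    α (.e i) = (α (.o .L i) ^^ α (.o .R i)) := by
  have hg := (h.mono (gate_subset_stripClauses (comparison_gate_subset (show i < 2 * n by omega)) 0
    (Or.inl (mem_stripStatic.mpr (Or.inl (mem_stripComparison.mpr ⟨i, ⟨h1, h2⟩, rfl⟩)))) ?_
    (Or.inr ⟨0, .o .L i, rfl, not_mem_stripComparison (by simp)⟩))).gateHolds
  · refine hg.trans ?_
    change ((!α (.o .L i) && α (.o .R i)) || (α (.o .L i) && !α (.o .R i))) = _
    cases α (.o .L i) <;> cases α (.o .R i) <;> rfl
  · intro s v hs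
    left
    fin_cases s <;> obtain rfl := Option.some_injective _ hs
    · exact mem_stripStatic_of_local .L h1 h2 (by simp)
    · exact mem_stripStatic_of_local .R h1 h2 (by simp)

/-- The clauses of the strip are not satisfied if `k` is the only position of the strip at which the
outputs differ. -/
theorem not_models_stripClauses {n lo k : ℕ} (hn : 2 ≤ n) (hk : k < 2 * n) (hlo : lo ≤ k)
    (hwidth : lo = 0 ∨ n * lastLayer n + 1 < 2 ^ (k - lo)) {α : WVar → Bool}
    (hlow : ∀ i, lo ≤ i → i < k → α (.e i) = false) (htop : α (.e k) = true) :
    ¬ Models α (stripClauses n lo k) := by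
  intro h
  obtain ⟨w, rfl⟩ := Nat.exists_eq_add_of_le hlo
  rw [Nat.add_sub_cancel_left] at hwidth
  obtain ⟨q₁, hq₁, hz₁, hm₁⟩ := (stripHolds hn hk .L h).sum_outputs hn hk
  obtain ⟨q₂, hq₂, hz₂, hm₂⟩ := (stripHolds hn hk .R h).sum_outputs hn hk
  have hcol : ∑ d ∈ Finset.range (w + 1), 2 ^ d * columnSum n .R α 0 (lo + d) =
      ∑ d ∈ Finset.range (w + 1), 2 ^ d * columnSum n .L α 0 (lo + d) := by
    refine Finset.sum_congr rfl fun d hd => ?_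
    have hd := Finset.mem_range.mp hd
    rw [columnSum_zero_comm (by omega)
      (fun r hr => partialProduct_holds hn hk .L h (by omega) (by omega) hr)
      (fun r hr => partialProduct_holds hn hk .R h (by omega) (by omega) hr)]
  rw [hcol] at hm₂
  have hQ : ∀ q, q ≤ n * lastLayer n + 1 → (lo = 0 → q = 0) → q < 2 ^ w := by
    intro q hq hz
    rcases hwidth with h0 | hw
    · rw [hz h0]; positivity
    · omega
  refine strip_contradiction hm₁ hm₂ (hQ _ hq₁ hz₁) (hQ _ hq₂ hz₂) (fun d hd => ?_) ?_
  · have := comparison_holds hk h (show lo ≤ lo + d by omega) (by omega)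
    rw [hlow _ (by omega) (by omega)] at this
    revert this
    cases α (.o .L (lo + d)) <;> cases α (.o .R (lo + d)) <;> simp
  · have := comparison_holds hk h hlo le_rfl
    rw [htop] at this
    revert this
    cases α (.o .L (lo + w)) <;> cases α (.o .R (lo + w)) <;> simp

end Wallace

theorem IsDerivation.union {V : Type} [DecidableEq V] {φ : Finset (Clause V)}
    {S S' : Finset (Clause V × Finset V)} (h : IsDerivation φ S) (h' : IsDerivation φ S') :
    IsDerivation φ (S ∪ S') := by
  intro q hq
  rcases Finset.mem_union.mp hq with hq | hq
  · exact (h q hq).mono Finset.subset_union_left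
  · exact (h' q hq).mono Finset.subset_union_right

theorem card_filter_interval_le (n Δ : ℕ) (a : ℤ) :
    ((Finset.range n).filter fun m : ℕ => a ≤ m ∧ (m : ℤ) ≤ a + Δ).card ≤ Δ + 1 := by
  have h := Finset.card_le_card_of_injOn (s := (Finset.range n).filter
    fun m : ℕ => a ≤ m ∧ (m : ℤ) ≤ a + Δ) (t := Finset.Icc a (a + Δ)) (fun m : ℕ => (m : ℤ))
    (fun m hm => Finset.mem_Icc.mpr (Finset.mem_filter.mp hm).2)
    (fun _ _ _ _ h => Int.ofNat_inj.mp h)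
  refine h.trans ?_
  rw [Int.card_Icc]
  omega

namespace Wallace

/-! ## Counting the variables of a strip -/

theorem card_sides_le : ({Side.L, Side.R} : Finset Side).card ≤ 2 := Finset.card_le_two

theorem card_unitVars_le (C : Side) (i l : ℕ) : (unitVars C i l).card ≤ 14 := by
  refine (Finset.card_union_le _ _).trans ?_
  have h1 := Finset.card_le_two (a := WVar.g C (l + 1) (i / 4 ^ (l + 1)))
    (b := WVar.p C (l + 1) (i / 4 ^ (l + 1)))
  have h2 := Finset.card_biUnion_le_card_mul (Finset.range 4) (fun s =>
    ({.g C l (4 * (i / 4 ^ (l + 1)) + s), .p C l (4 * (i / 4 ^ (l + 1)) + s),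
      .c C (4 ^ l * (4 * (i / 4 ^ (l + 1)) + s))} : Finset WVar)) 3
    (fun s _ => Finset.card_le_three)
  rw [Finset.card_range] at h2
  omega

theorem card_stripStatic_le (n lo k : ℕ) : (stripStatic n lo k).card ≤
    (k + 1 - lo) + 2 * ((k + 1 - lo) * (6 + claLevels n * 14)) := by
  refine (Finset.card_union_le _ _).trans (add_le_add ?_ ?_)
  · exact Finset.card_image_le.trans (by rw [Nat.card_Icc])
  · refine (Finset.card_biUnion_le_card_mul _ _ ((k + 1 - lo) * (6 + claLevels n * 14))
      fun C _ => ?_).trans (Nat.mul_le_mul_right _ card_sides_le)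
    refine (Finset.card_biUnion_le_card_mul _ _ (6 + claLevels n * 14) fun i _ => ?_).trans
      (by rw [Nat.card_Icc])
    refine (Finset.card_union_le _ _).trans (add_le_add Finset.card_le_six ?_)
    refine (Finset.card_biUnion_le_card_mul _ _ 14 fun l _ => card_unitVars_le C i l).trans ?_
    rw [Finset.card_range]

theorem card_stripDynamic_le (n lo k : ℕ) : (stripDynamic n lo k).card ≤
    n + n + 2 * (lastLayer n * ((k + 1 - lo) * n)) := by
  have hx : ∀ f : ℕ → WVar, ((Finset.range n).image f).card ≤ n := fun f =>
    Finset.card_image_le.trans (by rw [Finset.card_range])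
  refine (Finset.card_union_le _ _).trans (add_le_add
    ((Finset.card_union_le _ _).trans (add_le_add (hx _) (hx _))) ?_)
  refine (Finset.card_biUnion_le_card_mul _ _ (lastLayer n * ((k + 1 - lo) * n))
    fun C _ => ?_).trans (Nat.mul_le_mul_right _ card_sides_le)
  refine (Finset.card_biUnion_le_card_mul _ _ ((k + 1 - lo) * n) fun l _ => ?_).trans
    (by rw [Finset.card_range])
  exact (Finset.card_biUnion_le_card_mul _ _ n fun i _ => hx _).trans (by rw [Nat.card_Icc])

/-- The schedule replaces the factor n of `card_stripDynamic_le` by 4. -/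
theorem card_alive_stripDynamic_le (n lo k : ℕ) (t : ℤ) :
    ((stripDynamic n lo k).filter fun v => firstUse n lo k v ≤ t ∧ t ≤ lastUse n lo k v).card ≤
      (k - lo + 1) + (k - lo + 1) + 2 * (lastLayer n * ((k + 1 - lo) * 4)) := by
  simp only [stripDynamic, Finset.filter_union, Finset.filter_biUnion, Finset.filter_image]
  refine (Finset.card_union_le _ _).trans (add_le_add
    ((Finset.card_union_le _ _).trans (add_le_add ?_ ?_)) ?_)
  · refine Finset.card_image_le.trans ((Finset.card_le_card ?_).trans
      (card_filter_interval_le n (k - lo) ((min k (n - 1) : ℕ) - t - (k - lo : ℕ))))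
    intro m hm
    obtain ⟨hm1, hm2⟩ := Finset.mem_filter.mp hm
    simp only [firstUse, lastUse] at hm2
    exact Finset.mem_filter.mpr ⟨hm1, by omega, by omega⟩
  · refine Finset.card_image_le.trans ((Finset.card_le_card ?_).trans
      (card_filter_interval_le n (k - lo) (t + (k - (n - 1) : ℕ) - (k - lo : ℕ))))
    intro m hm
    obtain ⟨hm1, hm2⟩ := Finset.mem_filter.mp hm
    simp only [firstUse, lastUse] at hm2
    exact Finset.mem_filter.mpr ⟨hm1, by omega, by omega⟩
  · refine (Finset.card_biUnion_le_card_mul _ _ (lastLayer n * ((k + 1 - lo) * 4))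
      fun C _ => ?_).trans (Nat.mul_le_mul_right _ card_sides_le)
    refine (Finset.card_biUnion_le_card_mul _ _ ((k + 1 - lo) * 4) fun l _ => ?_).trans
      (by rw [Finset.card_range])
    refine (Finset.card_biUnion_le_card_mul _ _ 4 fun i _ => ?_).trans (by rw [Nat.card_Icc])
    refine Finset.card_image_le.trans ?_
    cases C
    · exact card_alive_le l n t
    -- Reversing time maps the intervals of R to those of L.
    · refine (Finset.card_le_card ?_).trans
        (card_alive_le l n ((min k (n - 1) : ℕ) - (k - (n - 1) : ℕ) - t))
      intro r hr
      obtain ⟨hr1, hr2⟩ := Finset.mem_filter.mp hr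
      simp only [firstUse, lastUse, sideTime] at hr2
      exact Finset.mem_filter.mpr ⟨hr1, by omega, by omega⟩

/-- Comparison bits stay unresolved within strips, so the final chain may resolve on each of them.
-/
theorem e_not_mem {n lo k i : ℕ} :
    WVar.e i ∉ (stripDynamic n lo k ∪ stripStatic n lo k) \ stripComparison lo k := by
  intro h
  obtain ⟨h, hE⟩ := Finset.mem_sdiff.mp h
  rcases Finset.mem_union.mp h with h | h
  · simp [stripDynamic] at h
  · rcases mem_stripStatic.mp h with h | ⟨C, i, -, h | ⟨l, -, h⟩⟩
    · exact hE h
    · simp at h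
    · simp [unitVars] at h

/-! ## The derivation for one strip -/

theorem exists_strip_derivation {n k : ℕ} (hn : 2 ≤ n) (hk : k < 2 * n) :
    ∃ S : Finset (Clause WVar × Finset WVar), IsDerivation (commInstance n) S ∧
      (∃ q ∈ S, ∀ p ∈ q.1, p = (.e k, false) ∨ ∃ i < k, p = (.e i, true)) ∧
      (∀ q ∈ S, ∀ i, .e i ∉ q.2) ∧ S.card ≤ 2 ^ (1900 * Nat.log 2 n ^ 2) := by
  set L := Nat.log 2 n with hL
  have hL1 : 1 ≤ L := Nat.log_pos (by norm_num) hn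
  have hnL : n < 2 ^ (L + 1) := Nat.lt_pow_succ_log_self (by norm_num) n
  have hLL : L ≤ L ^ 2 := Nat.le_self_pow (by norm_num) L
  have hlast : lastLayer n ≤ 5 * L := lastLayer_le.trans (by omega)
  have hcla : claLevels n ≤ 3 * L := by
    have : claLevels n ≤ L + 2 := by
      refine Nat.clog_le_of_le_pow ?_
      calc 2 * n ≤ 2 * 2 ^ (L + 1) := by omega
        _ = 2 ^ (L + 2) := by ring
        _ ≤ 4 ^ (L + 2) := Nat.pow_le_pow_left (by norm_num) _
    omega
  -- Width 2L + 3 suffices: the incoming carries number at most n² + 1, and n < 2^(L+1).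
  set lo := k - (2 * L + 3) with hlo
  have hlok : lo ≤ k := Nat.sub_le _ _
  have hwidth : lo = 0 ∨ n * lastLayer n + 1 < 2 ^ (k - lo) := by
    rcases Nat.eq_zero_or_pos lo with h | h
    · exact Or.inl h
    · right
      have e : k - lo = 2 * L + 3 := by omega
      rw [e]
      have h1 : n * lastLayer n ≤ n * n := Nat.mul_le_mul_left _ (lastLayer_le_self n)
      have h2 : n * n ≤ 2 ^ (L + 1) * 2 ^ (L + 1) := Nat.mul_le_mul hnL.le hnL.le
      have h3 : 2 ^ (2 * L + 3) = 2 * (2 ^ (L + 1) * 2 ^ (L + 1)) := by ring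
      have h4 : 2 ^ 2 ≤ 2 ^ (L + 1) := Nat.pow_le_pow_right (by norm_num) (by omega)
      have h5 := Nat.mul_le_mul h4 h4
      omega
  have hd : k + 1 - lo ≤ 6 * L := by omega
  have hstat : (stripStatic n lo k).card ≤ 582 * L ^ 2 := by
    refine (card_stripStatic_le n lo k).trans ?_
    calc (k + 1 - lo) + 2 * ((k + 1 - lo) * (6 + claLevels n * 14))
        ≤ 6 * L + 2 * (6 * L * (6 * L + 3 * L * 14)) := by gcongr; omega
      _ = 6 * L + 576 * L ^ 2 := by ring
      _ ≤ _ := by omega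
  have hlive : ∀ t : ℤ, ((stripDynamic n lo k).filter fun v =>
      firstUse n lo k v ≤ t ∧ t ≤ lastUse n lo k v).card + (stripStatic n lo k).card ≤ 900 * L ^ 2 := by
    intro t
    have h1 := card_alive_stripDynamic_le n lo k t
    have h2 : (k - lo + 1) + (k - lo + 1) + 2 * (lastLayer n * ((k + 1 - lo) * 4)) ≤
        6 * L + 6 * L + 2 * (5 * L * (6 * L * 4)) := by
      have : k - lo + 1 ≤ 6 * L := by omega
      gcongr
    have h3 : 6 * L + 6 * L + 2 * (5 * L * (6 * L * 4)) = 12 * L + 240 * L ^ 2 := by ring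
    omega
  -- A clause over the comparison bits that this assignment falsifies can contain only ¬e_k and
  -- positive e_i with i < k.
  let α : WVar → Bool := fun v => decide (v = .e k)
  obtain ⟨S, hS, ⟨q, hq, hqα, hqE⟩, hSM, hcard⟩ := exists_derivation_over
    (φ := commInstance n) (ψ := stripClauses n lo k) (Finset.filter_subset _ _)
    (stripDynamic n lo k) (stripStatic n lo k) (stripComparison lo k) (firstUse n lo k) (lastUse n lo k)
    (fun D hD => (Finset.mem_filter.mp hD).2.1) Finset.subset_union_left
    (fun D hD => (Finset.mem_filter.mp hD).2.2.1) (fun D hD => (Finset.mem_filter.mp hD).2.2.2)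
    hlive (α := α) (by
      intro β hβ
      have hmem : ∀ i, lo ≤ i → i ≤ k → WVar.e i ∈ stripComparison lo k := fun i h1 h2 =>
        mem_stripComparison.mpr ⟨i, ⟨h1, h2⟩, rfl⟩
      have := not_models_stripClauses hn hk hlok hwidth (α := β)
        (fun i h1 h2 => by rw [hβ _ (hmem i h1 h2.le)]; simp [α, h2.ne])
        (by rw [hβ _ (hmem k hlok le_rfl)]; simp [α])
      simpa [Models] using this)
  refine ⟨S, hS, ⟨q, hq, ?_⟩, fun q hq i hi => e_not_mem (hSM q hq hi), hcard.trans ?_⟩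
  · rintro ⟨v, b⟩ hp
    obtain ⟨i, ⟨-, h2⟩, rfl⟩ := mem_stripComparison.mp (hqE (Clause.mem_vars hp))
    have := hqα _ hp
    rcases h2.eq_or_lt with rfl | h2
    · left
      simpa [α] using this
    · right
      exact ⟨i, h2, by simpa [α, h2.ne] using this⟩
  · have hc : (stripDynamic n lo k ∪ stripStatic n lo k).card ≤ 2 ^ (14 * L ^ 2) := by
      refine (Finset.card_union_le _ _).trans ?_
      have h1 := card_stripDynamic_le n lo k
      have h2 : n + n + 2 * (lastLayer n * ((k + 1 - lo) * n)) ≤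
          n + n + 2 * (5 * L * (6 * L * n)) := by gcongr
      have h3 : n + n + 2 * (5 * L * (6 * L * n)) = 2 * n + 60 * (L ^ 2 * n) := by ring
      have h4 : n ≤ L ^ 2 * n := Nat.le_mul_of_pos_left _ (by positivity)
      have h5 : L ^ 2 ≤ L ^ 2 * n := Nat.le_mul_of_pos_right _ (by omega)
      have hL2 : L < 2 ^ L := Nat.lt_two_pow_self
      have h6 : L ^ 2 * n ≤ (2 ^ L) ^ 2 * 2 ^ (L + 1) := by gcongr
      calc _ ≤ 2 ^ 10 * (L ^ 2 * n) := by omega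
        _ ≤ 2 ^ 10 * ((2 ^ L) ^ 2 * 2 ^ (L + 1)) := Nat.mul_le_mul_left _ h6
        _ = 2 ^ (3 * L + 11) := by ring
        _ ≤ 2 ^ (14 * L ^ 2) := Nat.pow_le_pow_right (by norm_num) (by omega)
    calc _ ≤ 2 ^ (14 * L ^ 2) * (2 * 4 ^ (900 * L ^ 2 + 1)) := Nat.mul_le_mul_right _ hc
      _ = 2 ^ (14 * L ^ 2) * (2 * (2 ^ 2) ^ (900 * L ^ 2 + 1)) := by norm_num
      _ = 2 ^ (14 * L ^ 2 + (1 + 2 * (900 * L ^ 2 + 1))) := by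
        rw [← pow_mul, pow_add, pow_add 2 1, pow_one]
      _ ≤ 2 ^ (1900 * L ^ 2) := Nat.pow_le_pow_right (by norm_num) (by omega)

/-! ## Combination of the strips -/

/-- Descending order is what works: resolving e_j away introduces only e_i with i < j, so no pivot
returns and the annotation stays among indices ≥ 2n - d. -/
theorem exists_chain {n N : ℕ} (h : ∀ k < 2 * n, ∃ S : Finset (Clause WVar × Finset WVar),
      IsDerivation (commInstance n) S ∧
      (∃ q ∈ S, ∀ p ∈ q.1, p = (.e k, false) ∨ ∃ i < k, p = (.e i, true)) ∧
      (∀ q ∈ S, ∀ i, .e i ∉ q.2) ∧ S.card ≤ N) (d : ℕ) (hd : d ≤ 2 * n) :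
    ∃ S : Finset (Clause WVar × Finset WVar), IsDerivation (commInstance n) S ∧
      (∃ q ∈ S, (∀ p ∈ q.1, ∃ i < 2 * n - d, p = (.e i, true)) ∧
        ∀ i, .e i ∈ q.2 → 2 * n - d ≤ i) ∧ S.card ≤ 1 + d * (N + 1) := by
  induction d with
  | zero =>
    refine ⟨{((Finset.range (2 * n)).image fun i => (WVar.e i, true), ∅)}, ?_, ?_, by simp⟩
    · intro q hq
      rw [Finset.mem_singleton.mp hq]
      exact Or.inl (inequality_clause_mem n)
    · refine ⟨_, Finset.mem_singleton_self _, fun p hp => ?_, by simp⟩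
      obtain ⟨i, hi, rfl⟩ := Finset.mem_image.mp hp
      exact ⟨i, Finset.mem_range.mp hi, rfl⟩
  | succ d ih =>
    obtain ⟨S, hS, ⟨q, hq, hqp, hqM⟩, hcard⟩ := ih (by omega)
    obtain ⟨j, hj⟩ : ∃ j, 2 * n = j + (d + 1) := ⟨2 * n - (d + 1), by omega⟩
    have e1 : 2 * n - d = j + 1 := by omega
    have e2 : 2 * n - (d + 1) = j := by omega
    rw [e1] at hqp hqM
    rw [e2]
    obtain ⟨S', hS', ⟨q', hq', hqp'⟩, hM', hcard'⟩ := h j (by omega)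
    have hU := hS.union hS'
    have hcU := Finset.card_union_le S S'
    have hbound : 1 + (d + 1) * (N + 1) = 1 + d * (N + 1) + (N + 1) := by ring
    -- If the pivot is missing from either clause, that clause already consists of lower comparison
    -- bits and is kept.
    by_cases h1 : (WVar.e j, true) ∈ q.1
    · by_cases h2 : (WVar.e j, false) ∈ q'.1
      · let r : Clause WVar × Finset WVar :=
          (q.1.erase (.e j, true) ∪ q'.1.erase (.e j, false), insert (.e j) (q.2 ∪ q'.2))
        refine ⟨insert r (S ∪ S'), ?_, ⟨r, Finset.mem_insert_self _ _, ?_, ?_⟩, ?_⟩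
        · intro p hp
          rcases Finset.mem_insert.mp hp with rfl | hp
          · refine Or.inr ⟨.e j, q, Finset.mem_insert_of_mem (Finset.mem_union_left _ hq), q',
              Finset.mem_insert_of_mem (Finset.mem_union_right _ hq'), fun h => ?_, hM' q' hq' j,
              Finset.subset_union_left.trans (Finset.subset_insert _ _),
              Finset.subset_union_right.trans (Finset.subset_insert _ _),
              Finset.mem_insert_self _ _, h1, h2, rfl⟩
            have := hqM j h
            omega
          · exact (hU p hp).mono (Finset.subset_insert _ _)
        · intro p hp
          rcases Finset.mem_union.mp hp with hp | hp
          · obtain ⟨hne, hp⟩ := Finset.mem_erase.mp hp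
            obtain ⟨i, hi, rfl⟩ := hqp p hp
            refine ⟨i, lt_of_le_of_ne (by omega) fun hij => hne (by rw [hij]), rfl⟩
          · obtain ⟨hne, hp⟩ := Finset.mem_erase.mp hp
            exact (hqp' p hp).resolve_left hne
        · intro i hi
          rcases Finset.mem_insert.mp hi with hi | hi
          · exact (WVar.e.inj hi).ge
          · rcases Finset.mem_union.mp hi with hi | hi
            · have := hqM i hi
              omega
            · exact absurd hi (hM' q' hq' i)
        · have := Finset.card_insert_le r (S ∪ S')
          omega
      · refine ⟨S ∪ S', hU, ⟨q', Finset.mem_union_right _ hq', fun p hp => ?_, fun i hi =>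
          absurd hi (hM' q' hq' i)⟩, by omega⟩
        exact (hqp' p hp).resolve_left fun h => h2 (h ▸ hp)
    · refine ⟨S ∪ S', hU, ⟨q, Finset.mem_union_left _ hq, fun p hp => ?_, fun i hi => ?_⟩, by omega⟩
      · obtain ⟨i, hi, rfl⟩ := hqp p hp
        exact ⟨i, lt_of_le_of_ne (by omega) fun hij => h1 (hij ▸ hp), rfl⟩
      · have := hqM i hi
        omega

theorem exists_regular_refutation {n : ℕ} (hn : 2 ≤ n) :
    ∃ π : ResolutionRefutation (commInstance n),
      π.IsRegular ∧ π.size ≤ 2 ^ (2000 * Nat.log 2 n ^ 2) := by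
  obtain ⟨S, hS, ⟨q, hq, hqp, -⟩, hcard⟩ :=
    exists_chain (fun k hk => exists_strip_derivation hn hk) (2 * n) le_rfl
  have hq1 : q.1 = ∅ := Finset.eq_empty_of_forall_notMem fun p hp => by
    obtain ⟨i, hi, -⟩ := hqp p hp
    omega
  obtain ⟨π, hreg, hsize⟩ := hS.exists_refutation (M := q.2) (by rw [← hq1]; exact hq)
  refine ⟨π, hreg, hsize.trans (hcard.trans ?_)⟩
  set L := Nat.log 2 n with hL
  have hL1 : 1 ≤ L := Nat.log_pos (by norm_num) hn
  have hnL : n < 2 ^ (L + 1) := Nat.lt_pow_succ_log_self (by norm_num) n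
  have hLL : L ≤ L ^ 2 := Nat.le_self_pow (by norm_num) L
  have h1 : 1 ≤ 2 ^ (1900 * L ^ 2) := Nat.one_le_two_pow
  calc 1 + 2 * n * (2 ^ (1900 * L ^ 2) + 1)
      ≤ 1 * 2 ^ (1900 * L ^ 2) + 2 * n * (2 * 2 ^ (1900 * L ^ 2)) := by
        refine add_le_add (by omega) (Nat.mul_le_mul_left _ (by omega))
    _ = (1 + 4 * n) * 2 ^ (1900 * L ^ 2) := by ring
    _ ≤ 2 ^ (L + 4) * 2 ^ (1900 * L ^ 2) := by
        refine Nat.mul_le_mul_right _ ?_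
        have : 2 ^ (L + 4) = 8 * 2 ^ (L + 1) := by ring
        omega
    _ = 2 ^ (L + 4 + 1900 * L ^ 2) := by rw [← pow_add]
    _ ≤ 2 ^ (2000 * L ^ 2) := Nat.pow_le_pow_right (by norm_num) (by omega)

end Wallace

/-! ### The bound with the real logarithm -/

theorem mainTheorem7 :
    ∃ K : ℝ, 0 < K ∧ ∀ n : ℕ, 2 ≤ n →
      ∃ π : ResolutionRefutation (Wallace.commInstance n),
        π.IsRegular ∧ (π.size : ℝ) ≤ (2 : ℝ) ^ (K * Real.logb 2 n ^ 2) := by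
  refine ⟨2000, by norm_num, fun n hn => ?_⟩
  obtain ⟨π, hreg, hsize⟩ := Wallace.exists_regular_refutation hn
  refine ⟨π, hreg, ?_⟩
  have hlog : (Nat.log 2 n : ℝ) ≤ Real.logb 2 n := by
    rw [Real.le_logb_iff_rpow_le (by norm_num) (by positivity), Real.rpow_natCast]
    exact_mod_cast Nat.pow_log_le_self 2 (by omega)
  calc (π.size : ℝ) ≤ ((2 ^ (2000 * Nat.log 2 n ^ 2) : ℕ) : ℝ) := by exact_mod_cast hsize
    _ = (2 : ℝ) ^ (2000 * (Nat.log 2 n : ℝ) ^ 2) := by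
        rw [Nat.cast_pow, Nat.cast_ofNat, ← Real.rpow_natCast]
        push_cast
        rfl
    _ ≤ _ := by
        refine Real.rpow_le_rpow_of_exponent_le (by norm_num) ?_
        gcongr
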